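/- For complex $q$ with $|q|<1$ put $(q;q)_\infty=\prod_{n\ge1}(1-q^n)$ and let $(q;q)_\infty^{-3/5}$ be the branch that is holomorphic in the unit disc and equals $1$ at $q=0$. Let $U$ be an open subset of $\{0<|q|<1\}$ on which a continuous branch of $q^{1/5}$ is given, and for $q\in U$ define $$A(q)=q^{1/5}(q;q)_\infty^{-3/5}\sum_{n=-\infty}^{\infty}(-1)^nq^{(5n^2-3n)/2},\qquad B(q)=(q;q)_\infty^{-3/5}\sum_{n=-\infty}^{\infty}(-1)^nq^{(5n^2-n)/2},$$ and $\mathscr P(q)=E_2(q^5)$, where $E_2(q)=1-24\sum_{n=1}^{\infty}\bigl(\sum_{d\mid n}d\bigr)q^n$. Then $A$, $B$ and $\mathscr P$ are complex differentiable on $U$ and satisfy there the coupled nonlinear system $$q\frac{dA}{dq}=\frac1{60}A\left(-5A^{10}-66A^5B^5+7B^{10}+5\mathscr P\right),$$ $$q\frac{dB}{dq}=\frac1{60}B\left(7A^{10}+66A^5B^5-5B^{10}+5\mathscr P\right),$$ $$q\frac{d\mathscr P}{dq}=\frac5{12}\left(\mathscr P^2-B^{20}+12B^{15}A^5-14B^{10}A^{10}-12B^5A^{15}-A^{20}\right).$$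 -/

import Mathlib

namespace Quintic

/-- The infinite product `(q;q)_∞ = ∏_{n ≥ 1} (1 - q ^ n)`. -/
noncomputable def euler (q : ℂ) : ℂ := ∏' n : ℕ, (1 - q ^ (n + 1))

/-- The power `(q;q)_∞ ^ s` for `|q| < 1`: the branch that is holomorphic in the unit disc and equals
`1` at `q = 0`. Each factor `1 - q ^ n` has positive real part, so `log` here is the principal
logarithm away from its cut, and the sum is the logarithm of `(q;q)_∞` that vanishes at `q = 0`. -/
noncomputable def eulerPow (q s : ℂ) : ℂ :=
  Complex.exp (s * ∑' n : ℕ, Complex.log (1 - q ^ (n + 1)))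

/-- `A(q) = q^{1/5} (q;q)_∞^{-3/5} ∑_{n ∈ ℤ} (-1)^n q^{(5n² - 3n)/2}`, where the value of `q^{1/5}`
is `r q`. The integer division in the exponent is exact. -/
noncomputable def A (r : ℂ → ℂ) (q : ℂ) : ℂ :=
  r q * eulerPow q (-3 / 5) * ∑' n : ℤ, (-1) ^ n * q ^ ((5 * n ^ 2 - 3 * n) / 2)

/-- `B(q) = (q;q)_∞^{-3/5} ∑_{n ∈ ℤ} (-1)^n q^{(5n² - n)/2}`.
The integer division in the exponent is exact. -/
noncomputable def B (q : ℂ) : ℂ :=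
  eulerPow q (-3 / 5) * ∑' n : ℤ, (-1) ^ n * q ^ ((5 * n ^ 2 - n) / 2)

/-- `E₂(q) = 1 - 24 ∑_{n ≥ 1} (∑_{d ∣ n} d) q ^ n`. -/
noncomputable def E₂ (q : ℂ) : ℂ :=
  1 - 24 * ∑' n : ℕ+, (∑ d ∈ (n : ℕ).divisors, (d : ℂ)) * q ^ (n : ℕ)

/-- `𝒫(q) = E₂(q ^ 5)`. -/
noncomputable def P (q : ℂ) : ℂ := E₂ (q ^ 5)

theorem eulerPow_zero (s : ℂ) : eulerPow 0 s = 1 := by simp [eulerPow]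

theorem one_sub_pow_ne_zero {q : ℂ} (hq : ‖q‖ < 1) (n : ℕ) : 1 - q ^ (n + 1) ≠ 0 := by
  intro h
  have h1 : ‖q ^ (n + 1)‖ < 1 := by
    rw [norm_pow]
    exact pow_lt_one₀ (norm_nonneg _) hq (Nat.succ_ne_zero n)
  rw [← sub_eq_zero.mp h] at h1
  simp at h1

theorem summable_log {q : ℂ} (hq : ‖q‖ < 1) :
    Summable fun n : ℕ => Complex.log (1 - q ^ (n + 1)) := by
  have h : Summable fun n : ℕ => -q ^ (n + 1) :=
    (((summable_geometric_of_norm_lt_one hq).mul_left q).congr fun n => by ring).neg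
  simpa [sub_eq_add_neg] using Complex.summable_log_one_add_of_summable h

theorem eulerPow_one {q : ℂ} (hq : ‖q‖ < 1) : eulerPow q 1 = euler q := by
  rw [eulerPow, euler, one_mul]
  exact Complex.cexp_tsum_eq_tprod (fun n => one_sub_pow_ne_zero hq n) (summable_log hq)

theorem eulerPow_pow_five {q : ℂ} (hq : ‖q‖ < 1) :
    eulerPow q (-3 / 5) ^ 5 = (euler q ^ 3)⁻¹ := by
  rw [← eulerPow_one hq, eulerPow, eulerPow, ← Complex.exp_nat_mul, ← Complex.exp_nat_mul,
    ← Complex.exp_neg]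
  congr 1
  push_cast
  ring

end Quintic

/-! Put q = exp t, so that q d/dq becomes d/dt, and let θ(u) be `theta 0 u (5 * t)`. The points u =
t and u = 2t are 5-torsion for the quasi-period 5t: 3t and 4t are 5t - 2t and 5t - t, so addition
formulas at these points close up. The Jacobi triple product gives A^5 = -`alpha` and B^5 = -`beta`
(`cofactorA_pow_five`, `B_pow_five`), with `alpha` and `beta` monomials in θ'(0), θ(t), θ(2t) and
exp(t/2).

Since θ(u + w)θ(u - w) has rank two, Weierstrass's three-term identity holds; two derivatives of it
give `hess_sub_hess`, the formula for a difference of ℘-values as a product of thetas. At the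
torsion points this formula and its derivatives yield `curvB_sub_curvA`, the higher u-derivatives of
θ, and the key fact that the normalized logarithmic derivatives of θ are linear in `alpha` and
`beta` (`alpha_eq`, `beta_eq`).

The heat equation turns u-derivatives into t-derivatives, so everything is polynomial in `alpha`,
`beta` and one unknown, `curvA`. The derivative of `beta` is computed twice: from the monomial,
where θ'(0) = (q^5;q^5)_∞^3 brings in E₂(q^5), and from the linear relation. Comparison determines
`curvA` (`curvA_eq`). Differentiating that formula gives the equation for 𝒫; the equations for A and
B follow once `logEuler_deriv_eq` has eliminated E₂(q). -/

namespace Quintic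

open Complex Filter Topology

/-! ### Theta series: convergence, heat equation, quasi-periodicity -/

/-- The series `∑ (-1)^n (n + 1/2)^k exp ((n + 1/2) u + (n² + n)/2 v)` over the integers: for `k = 0`
an odd theta function of `u`, and for larger `k` its `k`-th derivative with respect to `u`. -/
noncomputable def theta (k : ℕ) (u v : ℂ) : ℂ :=
  ∑' n : ℤ, (-1) ^ n * ((n : ℂ) + 1 / 2) ^ k *
    exp (((n : ℂ) + 1 / 2) * u + ((n : ℂ) ^ 2 + n) / 2 * v)

theorem norm_neg_one_zpow (n : ℤ) : ‖(-1 : ℂ) ^ n‖ = 1 := by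
  rw [norm_zpow, norm_neg, norm_one, one_zpow]

theorem int_sq_add_self_nonneg (n : ℤ) : (0 : ℝ) ≤ ((n : ℝ) ^ 2 + n) / 2 := by
  have h : (0 : ℤ) ≤ n ^ 2 + n := by nlinarith [sq_nonneg (2 * n + 1)]
  have h2 : (0 : ℝ) ≤ (n : ℝ) ^ 2 + n := by exact_mod_cast h
  linarith

theorem abs_int_add_half_le (n : ℤ) : |(n : ℝ) + 1 / 2| ≤ |(n : ℝ)| + 1 := by
  refine (abs_add_le _ _).trans ?_
  norm_num

theorem summable_theta_bound (k : ℕ) (M : ℝ) {ε : ℝ} (hε : 0 < ε) :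
    Summable fun n : ℤ => |(n : ℝ) + 1 / 2| ^ k *
      Real.exp (|(n : ℝ) + 1 / 2| * |M| - ((n : ℝ) ^ 2 + n) / 2 * ε) := by
  have h := summable_pow_mul_jacobiTheta₂_term_bound ((|M| + 1 + ε / 2) / (2 * Real.pi))
    (T := ε / (2 * Real.pi)) (by positivity) 0
  refine Summable.of_nonneg_of_le (fun n => by positivity) (fun n => ?_)
    (h.mul_left (k.factorial * Real.exp (|M| + 1)))
  -- The polynomial factor is absorbed by x^k ≤ k! exp x, which is why |M| becomes |M| + 1.
  have h1 : |(n : ℝ) + 1 / 2| ^ k ≤ k.factorial * Real.exp |(n : ℝ) + 1 / 2| := by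
    have := Real.pow_div_factorial_le_exp _ (abs_nonneg ((n : ℝ) + 1 / 2)) k
    rwa [div_le_iff₀' (by positivity)] at this
  have h2 := abs_int_add_half_le n
  calc _ ≤ k.factorial * Real.exp |(n : ℝ) + 1 / 2| *
        Real.exp (|(n : ℝ) + 1 / 2| * |M| - ((n : ℝ) ^ 2 + n) / 2 * ε) := by gcongr
    _ = k.factorial * Real.exp (|(n : ℝ) + 1 / 2| * (|M| + 1) - ((n : ℝ) ^ 2 + n) / 2 * ε) := by
        rw [mul_assoc, ← Real.exp_add]; ring_nf
    _ ≤ k.factorial * Real.exp ((|(n : ℝ)| + 1) * (|M| + 1) -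
        ((n : ℝ) ^ 2 - |(n : ℝ)|) / 2 * ε) := by
        gcongr
        linarith [neg_abs_le (n : ℝ)]
    _ = _ := by
        rw [pow_zero, one_mul, mul_assoc, ← Real.exp_add]
        congr 2
        push_cast
        field_simp
        ring

theorem norm_theta_term_le (k : ℕ) (n : ℤ) {u v : ℂ} {M ε : ℝ} (hu : ‖u‖ ≤ M)
    (hv : v.re ≤ -ε) :
    ‖(-1 : ℂ) ^ n * ((n : ℂ) + 1 / 2) ^ k *
      exp (((n : ℂ) + 1 / 2) * u + ((n : ℂ) ^ 2 + n) / 2 * v)‖ ≤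
    |(n : ℝ) + 1 / 2| ^ k * Real.exp (|(n : ℝ) + 1 / 2| * |M| - ((n : ℝ) ^ 2 + n) / 2 * ε) := by
  have h1 : (n : ℂ) + 1 / 2 = (((n : ℝ) + 1 / 2 : ℝ) : ℂ) := by push_cast; ring
  have h2 : ((n : ℂ) ^ 2 + n) / 2 = ((((n : ℝ) ^ 2 + n) / 2 : ℝ) : ℂ) := by push_cast; ring
  rw [norm_mul, norm_mul, norm_neg_one_zpow, one_mul, h2, h1, norm_pow, norm_real, norm_exp,
    add_re, re_ofReal_mul, re_ofReal_mul, Real.norm_eq_abs]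
  gcongr
  have h3 : ((n : ℝ) + 1 / 2) * u.re ≤ |(n : ℝ) + 1 / 2| * |M| := by
    refine (le_abs_self _).trans ?_
    rw [abs_mul]
    exact mul_le_mul_of_nonneg_left ((abs_re_le_norm u).trans (hu.trans (le_abs_self M)))
      (abs_nonneg _)
  nlinarith [int_sq_add_self_nonneg n]

theorem summable_theta (k : ℕ) (u : ℂ) {v : ℂ} (hv : v.re < 0) :
    Summable fun n : ℤ => (-1 : ℂ) ^ n * ((n : ℂ) + 1 / 2) ^ k *
      exp (((n : ℂ) + 1 / 2) * u + ((n : ℂ) ^ 2 + n) / 2 * v) :=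
  Summable.of_norm_bounded (summable_theta_bound k ‖u‖ (neg_pos.mpr hv))
    fun n => norm_theta_term_le k n le_rfl (by simp)

/-- The derivative of the theta series along an affine line in the `(u, v)` plane. -/
theorem hasDerivAt_theta_affine (k : ℕ) (u v a b t : ℂ) (h : (v + b * t).re < 0) :
    HasDerivAt (fun w => theta k (u + a * w) (v + b * w))
      (a * theta (k + 1) (u + a * t) (v + b * t) +
        b / 2 * (theta (k + 2) (u + a * t) (v + b * t) - theta k (u + a * t) (v + b * t) / 4)) t := by
  set ε : ℝ := -(v + b * t).re / 2 with hεdef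
  have hε : 0 < ε := by linarith
  let S : Set ℂ := {w | ‖w - t‖ < 1} ∩ {w | (v + b * w).re < -ε}
  have hS : IsOpen S := by
    refine (isOpen_lt (by fun_prop) continuous_const).inter (isOpen_lt ?_ continuous_const)
    exact continuous_re.comp (by fun_prop)
  have htS : t ∈ S := ⟨by simp, by simp only [Set.mem_ofPred_eq]; linarith⟩
  let f : ℤ → ℂ → ℂ := fun n w => (-1 : ℂ) ^ n * ((n : ℂ) + 1 / 2) ^ k *
      exp (((n : ℂ) + 1 / 2) * (u + a * w) + ((n : ℂ) ^ 2 + n) / 2 * (v + b * w))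
  have hf' : ∀ n w, HasDerivAt (f n) ((-1 : ℂ) ^ n * ((n : ℂ) + 1 / 2) ^ k *
      (exp (((n : ℂ) + 1 / 2) * (u + a * w) + ((n : ℂ) ^ 2 + n) / 2 * (v + b * w)) *
        (((n : ℂ) + 1 / 2) * a + ((n : ℂ) ^ 2 + n) / 2 * b))) w := by
    intro n w
    refine ((HasDerivAt.cexp ?_).const_mul _)
    have h1 : HasDerivAt (fun w => u + a * w) a w := by
      simpa using ((hasDerivAt_id w).const_mul a).const_add u
    have h2 : HasDerivAt (fun w => v + b * w) b w := by
      simpa using ((hasDerivAt_id w).const_mul b).const_add v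
    exact (h1.const_mul _).add (h2.const_mul _)
  have hfd : ∀ n, DifferentiableOn ℂ (f n) S := fun n w _ =>
    (hf' n w).differentiableAt.differentiableWithinAt
  have hb : ∀ n w, w ∈ S → ‖f n w‖ ≤ |(n : ℝ) + 1 / 2| ^ k *
      Real.exp (|(n : ℝ) + 1 / 2| * |‖u‖ + ‖a‖ * (‖t‖ + 1)| - ((n : ℝ) ^ 2 + n) / 2 * ε) := by
    intro n w hw
    refine norm_theta_term_le k n ?_ hw.2.le
    refine (norm_add_le _ _).trans ?_
    rw [norm_mul]
    gcongr
    have := norm_add_le t (w - t)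
    rw [add_sub_cancel] at this
    exact this.trans (by linarith [hw.1.out])
  have hsum := summable_theta_bound k (‖u‖ + ‖a‖ * (‖t‖ + 1)) hε
  have hd := (differentiableOn_tsum_of_summable_norm hsum hfd hS hb).differentiableAt
    (hS.mem_nhds htS)
  have hs := hasSum_deriv_of_summable_norm hsum hfd hS hb htS
  have h1 := (summable_theta (k + 1) (u + a * t) h).hasSum.mul_left a
  -- Heat equation: (n² + n)/2 = ((n + 1/2)² - 1/4)/2, so a v-derivative is half of two
  -- u-derivatives less a quarter.
  have h2 := (((summable_theta (k + 2) (u + a * t) h).hasSum.sub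
    ((summable_theta k (u + a * t) h).hasSum.div_const 4)).mul_left (b / 2))
  have h3 := h1.add h2
  have h4 : deriv (fun w => ∑' n, f n w) t = _ := hs.unique (h3.congr_fun fun n => ?_)
  · have := hd.hasDerivAt
    rw [h4] at this
    exact this
  · rw [(hf' n t).deriv]
    ring

theorem hasDerivAt_theta_left (k : ℕ) (u : ℂ) {v : ℂ} (hv : v.re < 0) :
    HasDerivAt (fun u => theta k u v) (theta (k + 1) u v) u := by
  simpa using hasDerivAt_theta_affine k 0 v 1 0 u (by simpa using hv)

/-- The reflection n ↦ -1 - n negates n + 1/2, fixes n² + n and changes the sign of (-1)^n. -/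
theorem theta_neg (k : ℕ) (u v : ℂ) : theta k (-u) v = (-1) ^ (k + 1) * theta k u v := by
  rw [theta, theta, ← tsum_mul_left, ← (Equiv.subLeft (-1 : ℤ)).tsum_eq]
  refine tsum_congr fun n => ?_
  have h1 : (-1 : ℂ) ^ (-1 - n) = (-1) * (-1) ^ n := by
    rw [zpow_sub₀ (by norm_num), div_eq_mul_inv, ← inv_zpow]
    norm_num
  have h2 : (((-1 - n : ℤ) : ℂ) + 1 / 2) = -1 * ((n : ℂ) + 1 / 2) := by push_cast; ring
  rw [Equiv.subLeft_apply, h1, h2, mul_pow]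
  have h3 : (-1 * ((n : ℂ) + 1 / 2)) * -u + (((-1 - n : ℤ) : ℂ) ^ 2 + ((-1 - n : ℤ) : ℂ)) / 2 * v =
      ((n : ℂ) + 1 / 2) * u + ((n : ℂ) ^ 2 + n) / 2 * v := by push_cast; ring
  rw [h3, pow_succ]
  ring

theorem theta_term_add_period (k : ℕ) (n : ℤ) (u v : ℂ) :
    (-1 : ℂ) ^ (n - 1) * (((n - 1 : ℤ) : ℂ) + 1 / 2) ^ k *
      exp ((((n - 1 : ℤ) : ℂ) + 1 / 2) * (u + v) +
        (((n - 1 : ℤ) : ℂ) ^ 2 + ((n - 1 : ℤ) : ℂ)) / 2 * v) =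
    -exp (-u - v / 2) * ((-1 : ℂ) ^ n * ((n : ℂ) + 1 / 2 - 1) ^ k *
      exp (((n : ℂ) + 1 / 2) * u + ((n : ℂ) ^ 2 + n) / 2 * v)) := by
  have h1 : (-1 : ℂ) ^ (n - 1) = -(-1) ^ n := by rw [zpow_sub_one₀ (by norm_num)]; norm_num
  have h3 : (((n - 1 : ℤ) : ℂ) + 1 / 2) * (u + v) +
        (((n - 1 : ℤ) : ℂ) ^ 2 + ((n - 1 : ℤ) : ℂ)) / 2 * v =
      (-u - v / 2) + (((n : ℂ) + 1 / 2) * u + ((n : ℂ) ^ 2 + n) / 2 * v) := by push_cast; ring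
  rw [h3, exp_add, h1]
  push_cast
  ring

theorem theta_zero_add_period (u v : ℂ) :
    theta 0 (u + v) v = -exp (-u - v / 2) * theta 0 u v := by
  rw [theta, theta, ← tsum_mul_left, ← (Equiv.subRight (1 : ℤ)).tsum_eq]
  refine tsum_congr fun n => ?_
  rw [Equiv.subRight_apply, theta_term_add_period]
  simp

theorem theta_one_add_period (u : ℂ) {v : ℂ} (hv : v.re < 0) :
    theta 1 (u + v) v = -exp (-u - v / 2) * (theta 1 u v - theta 0 u v) := by
  rw [theta, theta, theta, ← (summable_theta 1 u hv).tsum_sub (summable_theta 0 u hv),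
    ← tsum_mul_left, ← (Equiv.subRight (1 : ℤ)).tsum_eq]
  refine tsum_congr fun n => ?_
  rw [Equiv.subRight_apply, theta_term_add_period]
  ring

theorem theta_zero_zero (v : ℂ) : theta 0 0 v = 0 := by
  have h := theta_neg 0 0 v
  rw [neg_zero] at h
  linear_combination h / 2

/-! ### Weierstrass's three-term identity -/

/-- The map `(t, s) ↦ (t + s, t - s)` on one copy and `(t, s) ↦ (t + s, t - s - 1)` on the other. -/
noncomputable def parityEquiv : (ℤ × ℤ) ⊕ (ℤ × ℤ) ≃ ℤ × ℤ :=
  Equiv.ofBijective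
    (Sum.elim (fun p => (p.1 + p.2, p.1 - p.2)) (fun p => (p.1 + p.2, p.1 - p.2 - 1))) <| by
    constructor
    · rintro (⟨a, b⟩ | ⟨a, b⟩) (⟨c, d⟩ | ⟨c, d⟩) h <;>
        simp only [Sum.elim_inl, Sum.elim_inr, Prod.mk.injEq, Sum.inl.injEq, Sum.inr.injEq,
          reduceCtorEq] at h ⊢ <;> omega
    · rintro ⟨m, n⟩
      rcases Int.even_or_odd' (m - n) with ⟨s, hs | hs⟩
      · exact ⟨.inl (n + s, s), by simp only [Sum.elim_inl, Prod.mk.injEq]; omega⟩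
      · exact ⟨.inr (n + s + 1, s), by simp only [Sum.elim_inr, Prod.mk.injEq]; omega⟩

theorem parityEquiv_inl (t s : ℤ) : parityEquiv (.inl (t, s)) = (t + s, t - s) := rfl

theorem parityEquiv_inr (t s : ℤ) : parityEquiv (.inr (t, s)) = (t + s, t - s - 1) := rfl

/-- In a product of two theta series, the sum and the difference of the two indices n + 1/2 are
integers of opposite parity when the signs (-1)^n agree, as in `parityEquiv`. This series and
`thetaOdd` collect the two parities. -/
noncomputable def thetaEven (u v : ℂ) : ℂ := ∑' n : ℤ, exp (2 * n * u + (n : ℂ) ^ 2 * v)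

noncomputable def thetaOdd (u v : ℂ) : ℂ :=
  ∑' n : ℤ, exp ((2 * n + 1) * u + ((n : ℂ) ^ 2 + n) * v)

theorem summable_gaussian (u : ℂ) {v : ℂ} (hv : v.re < 0) :
    Summable fun n : ℤ => exp (2 * n * u + (n : ℂ) ^ 2 * v) := by
  have h : 0 < (v / (Real.pi * I)).im := by
    have : v / (Real.pi * I) = ((Real.pi⁻¹ : ℝ) : ℂ) * (v * -I) := by
      rw [div_eq_mul_inv, mul_inv, inv_I]; push_cast; ring
    rw [this, im_ofReal_mul]
    have : 0 < Real.pi⁻¹ := by positivity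
    simp
    nlinarith
  refine ((summable_jacobiTheta₂_term_iff (u / (Real.pi * I)) _).mpr h).congr fun n => ?_
  have hpi : (Real.pi : ℂ) ≠ 0 := by exact_mod_cast Real.pi_ne_zero
  rw [jacobiTheta₂_term]
  congr 1
  field_simp [I_ne_zero]

theorem hasSum_thetaEven (u : ℂ) {v : ℂ} (hv : v.re < 0) :
    HasSum (fun n : ℤ => exp (2 * n * u + (n : ℂ) ^ 2 * v)) (thetaEven u v) :=
  (summable_gaussian u hv).hasSum

theorem hasSum_thetaOdd (u : ℂ) {v : ℂ} (hv : v.re < 0) :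
    HasSum (fun n : ℤ => exp ((2 * n + 1) * u + ((n : ℂ) ^ 2 + n) * v)) (thetaOdd u v) := by
  refine Summable.hasSum (((summable_gaussian (u + v / 2) hv).mul_left (exp u)).congr fun n => ?_)
  rw [← exp_add]
  ring_nf

theorem HasSum.mul_of_norm {f g : ℤ → ℂ} {a b : ℂ} (hf : HasSum f a) (hg : HasSum g b) :
    HasSum (fun p : ℤ × ℤ => f p.1 * g p.2) (a * b) :=
  HasSum.mul hf hg (summable_mul_of_summable_norm hf.summable.norm hg.summable.norm)

/-- The product `θ(u + w) θ(u - w)` has rank two as a function of `u` and `w`. -/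
theorem theta_add_mul_theta_sub (u w : ℂ) {v : ℂ} (hv : v.re < 0) :
    theta 0 (u + w) v * theta 0 (u - w) v =
      thetaOdd u v * thetaEven w v - thetaEven u v * thetaOdd w v := by
  have h := HasSum.mul_of_norm (summable_theta 0 (u + w) hv).hasSum
    (summable_theta 0 (u - w) hv).hasSum
  rw [← parityEquiv.hasSum_iff] at h
  have h1 := HasSum.mul_of_norm (hasSum_thetaOdd u hv) (hasSum_thetaEven w hv)
  have h2 := (HasSum.mul_of_norm (hasSum_thetaEven u hv) (hasSum_thetaOdd w hv)).neg
  refine (h.unique (HasSum.sum ?_ ?_)).trans (sub_eq_add_neg _ _).symm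
  · refine h1.congr_fun fun p => ?_
    obtain ⟨t, s⟩ := p
    simp only [Function.comp_apply, parityEquiv_inl, pow_zero, mul_one]
    rw [mul_mul_mul_comm, ← zpow_add₀ (by norm_num), ← exp_add, ← exp_add]
    have : (-1 : ℂ) ^ (t + s + (t - s)) = 1 := Even.neg_one_zpow ⟨t, by ring⟩
    rw [this, one_mul]
    congr 1
    push_cast
    ring
  · refine h2.congr_fun fun p => ?_
    obtain ⟨t, s⟩ := p
    simp only [Function.comp_apply, parityEquiv_inr, pow_zero, mul_one]
    rw [mul_mul_mul_comm, ← zpow_add₀ (by norm_num), ← exp_add, ← exp_add]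
    have : (-1 : ℂ) ^ (t + s + (t - s - 1)) = -1 := Odd.neg_one_zpow ⟨t - 1, by ring⟩
    rw [this, neg_one_mul]
    congr 2
    push_cast
    ring

/-- Weierstrass's three-term identity. -/
theorem theta_three_term (a b c : ℂ) {v : ℂ} (hv : v.re < 0) :
    theta 0 (a + b) v * theta 0 (a - b) v * theta 0 c v ^ 2
      - theta 0 (a + c) v * theta 0 (a - c) v * theta 0 b v ^ 2
      + theta 0 a v ^ 2 * (theta 0 (b + c) v * theta 0 (b - c) v) = 0 := by
  have h0 : ∀ x, theta 0 x v ^ 2 =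
      thetaOdd x v * thetaEven 0 v - thetaEven x v * thetaOdd 0 v := fun x => by
    rw [← theta_add_mul_theta_sub x 0 hv, add_zero, sub_zero, sq]
  -- All six factors are now 2 × 2 minors of vectors (`thetaOdd`, `thetaEven`), taken at a, b, c and
  -- 0; the identity is their Plücker relation.
  rw [h0, h0, h0, theta_add_mul_theta_sub _ _ hv, theta_add_mul_theta_sub _ _ hv,
    theta_add_mul_theta_sub _ _ hv]
  ring

/-! ### Differences of second logarithmic derivatives and duplication -/

/-- `θ² (log θ)''`. -/
noncomputable def hess (u v : ℂ) : ℂ := theta 0 u v * theta 2 u v - theta 1 u v ^ 2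

noncomputable def hess' (u v : ℂ) : ℂ := theta 0 u v * theta 3 u v - theta 1 u v * theta 2 u v

noncomputable def hess'' (u v : ℂ) : ℂ := theta 0 u v * theta 4 u v - theta 2 u v ^ 2

theorem hasDerivAt_theta_add (k : ℕ) (a c : ℂ) {v : ℂ} (hv : v.re < 0) :
    HasDerivAt (fun c => theta k (a + c) v) (theta (k + 1) (a + c) v) c :=
  (hasDerivAt_theta_left k (a + c) hv).comp_const_add a c

theorem hasDerivAt_theta_sub (k : ℕ) (a c : ℂ) {v : ℂ} (hv : v.re < 0) :
    HasDerivAt (fun c => theta k (a - c) v) (-theta (k + 1) (a - c) v) c :=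
  (hasDerivAt_theta_left k (a - c) hv).comp_const_sub a c

theorem hasDerivAt_theta_sub_const (k : ℕ) (a c : ℂ) {v : ℂ} (hv : v.re < 0) :
    HasDerivAt (fun a => theta k (a - c) v) (theta (k + 1) (a - c) v) a :=
  (hasDerivAt_theta_left k (a - c) hv).comp_sub_const a c

theorem hasDerivAt_theta_add_const (k : ℕ) (a c : ℂ) {v : ℂ} (hv : v.re < 0) :
    HasDerivAt (fun a => theta k (a + c) v) (theta (k + 1) (a + c) v) a :=
  (hasDerivAt_theta_left k (a + c) hv).comp_add_const a c

/-- The difference of two values of `(log θ)''`, as a product. -/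
theorem hess_sub_hess (a b : ℂ) {v : ℂ} (hv : v.re < 0) :
    theta 1 0 v ^ 2 * (theta 0 (a + b) v * theta 0 (a - b) v) =
      hess a v * theta 0 b v ^ 2 - hess b v * theta 0 a v ^ 2 := by
  have d1 : ∀ k c, HasDerivAt (fun c => theta k c v) (theta (k + 1) c v) c :=
    fun k c => hasDerivAt_theta_left k c hv
  have da : ∀ k a c, HasDerivAt (fun c => theta k (a + c) v) (theta (k + 1) (a + c) v) c :=
    fun k a c => hasDerivAt_theta_add k a c hv
  have ds : ∀ k a c, HasDerivAt (fun c => theta k (a - c) v) (-theta (k + 1) (a - c) v) c :=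
    fun k a c => hasDerivAt_theta_sub k a c hv
  -- The three-term identity is differentiated twice in c: once at every c, then at c = 0, where
  -- θ(0) = 0 leaves θ'(0)² and the two `hess` terms.
  have first : ∀ c, 2 * (theta 0 (a + b) v * theta 0 (a - b) v) * (theta 0 c v * theta 1 c v)
      - (theta 1 (a + c) v * theta 0 (a - c) v - theta 0 (a + c) v * theta 1 (a - c) v) *
        theta 0 b v ^ 2
      + theta 0 a v ^ 2 *
        (theta 1 (b + c) v * theta 0 (b - c) v - theta 0 (b + c) v * theta 1 (b - c) v) = 0 := by
    intro c
    have h := (((d1 0 c).fun_pow 2).const_mul (theta 0 (a + b) v * theta 0 (a - b) v)).fun_sub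
      (((da 0 a c).fun_mul (ds 0 a c)).mul_const (theta 0 b v ^ 2))
    have h' := h.fun_add (((da 0 b c).fun_mul (ds 0 b c)).const_mul (theta 0 a v ^ 2))
    have h0 : HasDerivAt (fun _ : ℂ => (0 : ℂ)) 0 c := hasDerivAt_const c 0
    have e := h'.unique (h0.congr_of_eventuallyEq
      (Filter.Eventually.of_forall fun c => theta_three_term a b c hv))
    norm_num at e
    linear_combination e
  have h := (((d1 0 0).fun_mul (d1 1 0)).const_mul
      (2 * (theta 0 (a + b) v * theta 0 (a - b) v))).fun_sub
    ((((da 1 a 0).fun_mul (ds 0 a 0)).fun_sub ((da 0 a 0).fun_mul (ds 1 a 0))).mul_const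
      (theta 0 b v ^ 2))
  have h' := h.fun_add ((((da 1 b 0).fun_mul (ds 0 b 0)).fun_sub
    ((da 0 b 0).fun_mul (ds 1 b 0))).const_mul (theta 0 a v ^ 2))
  have h0 : HasDerivAt (fun _ : ℂ => (0 : ℂ)) 0 0 := hasDerivAt_const 0 0
  have e := h'.unique (h0.congr_of_eventuallyEq
    (Filter.Eventually.of_forall first))
  simp only [theta_zero_zero, add_zero, sub_zero, zero_add, one_add_one_eq_two] at e
  rw [hess, hess]
  linear_combination e / 2

theorem hasDerivAt_hess (a : ℂ) {v : ℂ} (hv : v.re < 0) :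
    HasDerivAt (fun a => hess a v) (hess' a v) a := by
  have h := ((hasDerivAt_theta_left 0 a hv).fun_mul (hasDerivAt_theta_left 2 a hv)).fun_sub
    ((hasDerivAt_theta_left 1 a hv).fun_pow 2)
  refine h.congr_deriv ?_
  rw [hess']
  norm_num
  ring

theorem hasDerivAt_hess' (a : ℂ) {v : ℂ} (hv : v.re < 0) :
    HasDerivAt (fun a => hess' a v) (hess'' a v) a := by
  have h := ((hasDerivAt_theta_left 0 a hv).fun_mul (hasDerivAt_theta_left 3 a hv)).fun_sub
    ((hasDerivAt_theta_left 1 a hv).fun_mul (hasDerivAt_theta_left 2 a hv))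
  refine h.congr_deriv ?_
  rw [hess'']
  norm_num
  ring

theorem hess_sub_hess_deriv_left (a b : ℂ) {v : ℂ} (hv : v.re < 0) :
    theta 1 0 v ^ 2 * (theta 1 (a + b) v * theta 0 (a - b) v +
        theta 0 (a + b) v * theta 1 (a - b) v) =
      hess' a v * theta 0 b v ^ 2 - 2 * hess b v * (theta 0 a v * theta 1 a v) := by
  have h1 := ((hasDerivAt_theta_add_const 0 a b hv).fun_mul
    (hasDerivAt_theta_sub_const 0 a b hv)).const_mul (theta 1 0 v ^ 2)
  have h2 := ((hasDerivAt_hess a hv).mul_const (theta 0 b v ^ 2)).fun_sub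
    (((hasDerivAt_theta_left 0 a hv).fun_pow 2).const_mul (hess b v))
  have e := h1.unique (h2.congr_of_eventuallyEq
    (Filter.Eventually.of_forall fun a => hess_sub_hess a b hv))
  norm_num at e
  linear_combination e

theorem hess_sub_hess_deriv_right (a b : ℂ) {v : ℂ} (hv : v.re < 0) :
    theta 1 0 v ^ 2 * (theta 1 (a + b) v * theta 0 (a - b) v -
        theta 0 (a + b) v * theta 1 (a - b) v) =
      2 * hess a v * (theta 0 b v * theta 1 b v) - hess' b v * theta 0 a v ^ 2 := by
  have h1 := ((hasDerivAt_theta_add 0 a b hv).fun_mul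
    (hasDerivAt_theta_sub 0 a b hv)).const_mul (theta 1 0 v ^ 2)
  have h2 := (((hasDerivAt_theta_left 0 b hv).fun_pow 2).const_mul (hess a v)).fun_sub
    ((hasDerivAt_hess b hv).mul_const (theta 0 a v ^ 2))
  have e := h1.unique (h2.congr_of_eventuallyEq
    (Filter.Eventually.of_forall fun b => hess_sub_hess a b hv))
  norm_num at e
  linear_combination e

/-- The duplication formula for `θ`. -/
theorem theta_two_mul (a : ℂ) {v : ℂ} (hv : v.re < 0) :
    -theta 1 0 v ^ 3 * theta 0 (2 * a) v =
      2 * hess a v * (theta 0 a v * theta 1 a v) - hess' a v * theta 0 a v ^ 2 := by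
  -- At b = a the factor θ(a - b) vanishes and its derivative is θ'(0).
  rw [← hess_sub_hess_deriv_right a a hv, sub_self, theta_zero_zero, two_mul]
  ring

theorem theta_two_mul_deriv (a : ℂ) {v : ℂ} (hv : v.re < 0) :
    -2 * theta 1 0 v ^ 3 * theta 1 (2 * a) v =
      2 * hess a v * (theta 1 a v ^ 2 + theta 0 a v * theta 2 a v) -
        hess'' a v * theta 0 a v ^ 2 := by
  have h1 := (((hasDerivAt_theta_left 0 (2 * a) hv).comp a
    ((hasDerivAt_id a).const_mul 2))).const_mul (-theta 1 0 v ^ 3)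
  have h2 := (((hasDerivAt_hess a hv).const_mul 2).fun_mul
    ((hasDerivAt_theta_left 0 a hv).fun_mul (hasDerivAt_theta_left 1 a hv))).fun_sub
    ((hasDerivAt_hess' a hv).fun_mul ((hasDerivAt_theta_left 0 a hv).fun_pow 2))
  have e := h1.unique (h2.congr_of_eventuallyEq
    (Filter.Eventually.of_forall fun a => theta_two_mul a hv))
  norm_num at e
  linear_combination e

/-! ### The Jacobi triple product -/

theorem multipliable_one_sub_mul_pow {q : ℂ} (hq : ‖q‖ < 1) (z : ℂ) :
    Multipliable fun i : ℕ => 1 - z * q ^ i := by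
  have h : Summable fun i : ℕ => ‖-(z * q ^ i)‖ :=
    ((summable_geometric_of_norm_lt_one hq).mul_left z).neg.norm
  simpa [sub_eq_add_neg] using multipliable_one_add_of_summable h

theorem tprod_one_sub_mul_pow_ne_zero {q : ℂ} (hq : ‖q‖ < 1) {z : ℂ}
    (hz : ∀ i : ℕ, 1 - z * q ^ i ≠ 0) : ∏' i : ℕ, (1 - z * q ^ i) ≠ 0 := by
  have h : Summable fun i : ℕ => ‖-(z * q ^ i)‖ :=
    ((summable_geometric_of_norm_lt_one hq).mul_left z).neg.norm
  simpa [sub_eq_add_neg] using tprod_one_add_ne_zero_of_summable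
    (f := fun i => -(z * q ^ i)) (fun i => by simpa [sub_eq_add_neg] using hz i) h

theorem tendsto_prod_one_sub_mul_pow {q : ℂ} (hq : ‖q‖ < 1) (z : ℂ) :
    Tendsto (fun N : ℕ => ∏ i ∈ Finset.range N, (1 - z * q ^ i)) atTop
      (𝓝 (∏' i : ℕ, (1 - z * q ^ i))) :=
  (multipliable_one_sub_mul_pow hq z).hasProd.tendsto_prod_nat

theorem euler_eq_tprod (q : ℂ) : euler q = ∏' i : ℕ, (1 - q * q ^ i) :=
  tprod_congr fun i => by rw [pow_succ']

theorem euler_ne_zero {q : ℂ} (hq : ‖q‖ < 1) : euler q ≠ 0 := by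
  rw [← eulerPow_one hq]
  exact exp_ne_zero _

/-- The finite product `(q;q)_N`. -/
noncomputable def eulerFinite (q : ℂ) (N : ℕ) : ℂ := ∏ i ∈ Finset.range N, (1 - q * q ^ i)

theorem eulerFinite_ne_zero {q : ℂ} (hq : ‖q‖ < 1) (N : ℕ) : eulerFinite q N ≠ 0 :=
  Finset.prod_ne_zero_iff.mpr fun i _ => by simpa [pow_succ'] using one_sub_pow_ne_zero hq i

theorem eulerFinite_succ (q : ℂ) (N : ℕ) :
    eulerFinite q (N + 1) = eulerFinite q N * (1 - q ^ (N + 1)) := by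
  rw [eulerFinite, Finset.prod_range_succ, ← pow_succ', eulerFinite]

theorem tendsto_eulerFinite {q : ℂ} (hq : ‖q‖ < 1) :
    Tendsto (eulerFinite q) atTop (𝓝 (euler q)) := by
  rw [euler_eq_tprod]
  exact tendsto_prod_one_sub_mul_pow hq q

/-- The reciprocal of `(q;q)_m`, extended by zero to negative `m`. -/
noncomputable def eulerInv (q : ℂ) (m : ℤ) : ℂ := if m < 0 then 0 else (eulerFinite q m.toNat)⁻¹

theorem eulerInv_natCast (q : ℂ) (m : ℕ) : eulerInv q m = (eulerFinite q m)⁻¹ := by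
  simp [eulerInv]

theorem eulerInv_of_neg (q : ℂ) {m : ℤ} (hm : m < 0) : eulerInv q m = 0 := by
  simp [eulerInv, hm]

theorem eulerInv_sub_one {q : ℂ} (hq : ‖q‖ < 1) (m : ℤ) :
    eulerInv q (m - 1) = (1 - q ^ m) * eulerInv q m := by
  rcases lt_trichotomy m 0 with hm | rfl | hm
  · rw [eulerInv_of_neg q hm, eulerInv_of_neg q (by omega), mul_zero]
  · rw [eulerInv_of_neg q (by omega), zpow_zero, sub_self, zero_mul]
  · obtain ⟨k, rfl⟩ : ∃ k : ℕ, m = ((k + 1 : ℕ) : ℤ) := ⟨m.toNat - 1, by omega⟩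
    rw [show ((k + 1 : ℕ) : ℤ) - 1 = (k : ℕ) by push_cast; ring, eulerInv_natCast,
      eulerInv_natCast, eulerFinite_succ, zpow_natCast]
    have h1 := one_sub_pow_ne_zero hq k
    have h2 := eulerFinite_ne_zero hq k
    field_simp

/-- The general term of the series in the Jacobi triple product identity. -/
noncomputable def tripleTerm (q z : ℂ) (n : ℤ) : ℂ := (-1) ^ n * q ^ (n * (n - 1) / 2) * z ^ n

theorem tripleTerm_succ {q z : ℂ} (hq : q ≠ 0) (hz : z ≠ 0) (n : ℤ) :
    tripleTerm q z (n + 1) = -q ^ n * z * tripleTerm q z n := by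
  have h : (n + 1) * (n + 1 - 1) / 2 = n * (n - 1) / 2 + n := by
    rw [show (n + 1) * (n + 1 - 1) = n * (n - 1) + n * 2 by ring]
    exact Int.add_mul_ediv_right _ _ (by norm_num)
  rw [tripleTerm, tripleTerm, h, zpow_add₀ hq, zpow_add_one₀ hz, zpow_add_one₀ (by norm_num)]
  ring

/-- The Gaussian binomial coefficient of 2N over N + n. As `eulerInv` vanishes at negative
arguments, it is zero for |n| > N and its recurrence needs no boundary cases. -/
noncomputable def tripleCoeff (q : ℂ) (N : ℕ) (n : ℤ) : ℂ :=
  eulerFinite q (2 * N) * (eulerInv q (N + n) * eulerInv q (N - n))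

/-- This is the recurrence forced by the new factor (1 - z q^N)(1 - q^(N+1)/z) in the finite
product. -/
theorem tripleCoeff_succ {q : ℂ} (hq0 : q ≠ 0) (hq : ‖q‖ < 1) (N : ℕ) (n : ℤ) :
    tripleCoeff q (N + 1) n = (1 + q ^ (2 * N + 1)) * tripleCoeff q N n +
      q ^ ((N : ℤ) + 1 - n) * tripleCoeff q N (n - 1) +
      q ^ ((N : ℤ) + 1 + n) * tripleCoeff q N (n + 1) := by
  simp only [tripleCoeff]
  set s : ℤ := (N : ℤ) + 1 + n with hs
  set t : ℤ := (N : ℤ) + 1 - n with ht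
  rw [show ((N + 1 : ℕ) : ℤ) + n = s by push_cast; omega,
    show ((N + 1 : ℕ) : ℤ) - n = t by push_cast; omega,
    show (N : ℤ) + n = s - 1 by omega, show (N : ℤ) - n = t - 1 by omega,
    show (N : ℤ) + (n - 1) = s - 1 - 1 by omega, show (N : ℤ) - (n - 1) = t by omega,
    show (N : ℤ) + (n + 1) = s by omega, show (N : ℤ) - (n + 1) = t - 1 - 1 by omega,
    eulerInv_sub_one hq (s - 1), eulerInv_sub_one hq (t - 1), eulerInv_sub_one hq s,
    eulerInv_sub_one hq t, show 2 * (N + 1) = 2 * N + 1 + 1 by ring, eulerFinite_succ,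
    eulerFinite_succ, zpow_sub_one₀ hq0, zpow_sub_one₀ hq0]
  have hst : q ^ s * q ^ t = q ^ (2 * N + 1) * q := by
    rw [← zpow_add₀ hq0, ← pow_succ, ← zpow_natCast]
    congr 1
    push_cast
    omega
  have hqq : q * q⁻¹ = 1 := mul_inv_cancel₀ hq0
  rw [pow_succ q (2 * N + 1)]
  generalize q ^ s = S at *
  generalize q ^ t = T at *
  generalize q ^ (2 * N + 1) = M at *
  generalize eulerInv q s = a
  generalize eulerInv q t = b
  generalize eulerFinite q (2 * N) = F
  generalize q⁻¹ = p at *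
  -- Here S T = q^(2N+2) = M q; cancelling F a b leaves a polynomial identity modulo this relation
  -- and q p = 1.
  have key : (1 - M) * (1 - M * q) = (1 + M) * ((1 - S) * (1 - T)) +
      T * ((1 - S * p) * (1 - S)) + S * ((1 - T * p) * (1 - T)) := by
    linear_combination (1 - M + p * 2 - p * S - p * T) * hst +
      (2 * M - S * M - M * T) * hqq
  linear_combination F * a * b * key

theorem hasSum_finite_triple {q z : ℂ} (hq0 : q ≠ 0) (hq : ‖q‖ < 1) (hz : z ≠ 0) (N : ℕ) :
    HasSum (fun n : ℤ => tripleCoeff q N n * tripleTerm q z n)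
      ((∏ i ∈ Finset.range N, (1 - z * q ^ i)) *
        ∏ i ∈ Finset.range N, (1 - q / z * q ^ i)) := by
  induction N with
  | zero =>
    have h := hasSum_single (f := fun n : ℤ => tripleCoeff q 0 n * tripleTerm q z n) 0
      (fun n hn => ?_)
    · simpa [tripleCoeff, tripleTerm, eulerInv, eulerFinite] using h
    · rcases lt_or_gt_of_ne hn with h | h
      · simp [tripleCoeff, eulerInv_of_neg q h]
      · simp [tripleCoeff, eulerInv_of_neg q (neg_neg_of_pos h)]
  | succ N ih =>
    have h1 := (Equiv.subRight (1 : ℤ)).hasSum_iff.mpr ih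
    have h2 := (Equiv.addRight (1 : ℤ)).hasSum_iff.mpr ih
    have h3 := ((ih.mul_left (1 + q ^ (2 * N + 1))).sub (h1.mul_left (z * q ^ N))).sub
      (h2.mul_left (q ^ (N + 1) / z))
    rw [Finset.prod_range_succ, Finset.prod_range_succ]
    convert! h3 using 1
    · funext n
      simp only [Function.comp_apply, Equiv.subRight_apply, Equiv.coe_addRight]
      have e1 := tripleTerm_succ hq0 hz (n - 1)
      rw [sub_add_cancel] at e1
      rw [tripleTerm_succ hq0 hz n, tripleCoeff_succ hq0 hq, e1, zpow_sub_one₀ hq0,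
        zpow_add₀ hq0, zpow_sub₀ hq0, zpow_add_one₀ hq0, zpow_natCast]
      have : q ^ n ≠ 0 := zpow_ne_zero n hq0
      field_simp
      ring
    · field_simp
      ring

theorem tendsto_eulerInv {q : ℂ} (hq : ‖q‖ < 1) {f : ℕ → ℤ} (hf : Tendsto f atTop atTop) :
    Tendsto (fun N => eulerInv q (f N)) atTop (𝓝 (euler q)⁻¹) := by
  have h1 : Tendsto (fun N => (f N).toNat) atTop atTop :=
    tendsto_atTop.mpr fun b => (hf.eventually_ge_atTop (b : ℤ)).mono fun N hN => by omega
  refine (((tendsto_eulerFinite hq).comp h1).inv₀ (euler_ne_zero hq)).congr' ?_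
  filter_upwards [hf.eventually_ge_atTop 0] with N hN
  simp [eulerInv, not_lt.mpr hN]

/-- Uniformity in both N and n supplies the dominating series for the limit N → ∞. -/
theorem exists_norm_tripleCoeff_le {q : ℂ} (hq : ‖q‖ < 1) :
    ∃ K, ∀ N n, ‖tripleCoeff q N n‖ ≤ K := by
  obtain ⟨A, hA⟩ := (tendsto_eulerFinite hq).norm.bddAbove_range
  obtain ⟨B, hB⟩ := ((tendsto_eulerFinite hq).inv₀ (euler_ne_zero hq)).norm.bddAbove_range
  have hA' : ∀ N, ‖eulerFinite q N‖ ≤ A := fun N => hA ⟨N, rfl⟩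
  have hB' : ∀ N, ‖(eulerFinite q N)⁻¹‖ ≤ B := fun N => hB ⟨N, rfl⟩
  have hB0 : 0 ≤ B := (norm_nonneg _).trans (hB' 0)
  have hB'' : ∀ m, ‖eulerInv q m‖ ≤ B := fun m => by
    rw [eulerInv]
    split_ifs
    · simpa using hB0
    · exact hB' _
  refine ⟨A * (B * B), fun N n => ?_⟩
  rw [tripleCoeff, norm_mul, norm_mul]
  exact mul_le_mul (hA' _) (mul_le_mul (hB'' _) (hB'' _) (norm_nonneg _) hB0)
    (by positivity) ((norm_nonneg _).trans (hA' 0))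

theorem tripleTerm_exp (w v : ℂ) (n : ℤ) : tripleTerm (exp v) (exp w) n =
    exp ((v - w) / 2) * ((-1) ^ n * ((n : ℂ) + 1 / 2) ^ 0 *
      exp (((n : ℂ) + 1 / 2) * (w - v) + ((n : ℂ) ^ 2 + n) / 2 * v)) := by
  obtain ⟨m, hm⟩ : Even (n * (n - 1)) := Int.even_mul_pred_self n
  have h1 : n * (n - 1) / 2 = m := by omega
  have h2 : (n : ℂ) * (n - 1) = m + m := by exact_mod_cast hm
  rw [tripleTerm, h1, ← exp_int_mul, ← exp_int_mul, mul_assoc, ← exp_add, pow_zero, mul_one,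
    mul_left_comm, ← exp_add]
  congr 2
  linear_combination -h2 * v / 2

theorem hasSum_tripleTerm_exp (w : ℂ) {v : ℂ} (hv : v.re < 0) :
    HasSum (tripleTerm (exp v) (exp w)) (exp ((v - w) / 2) * theta 0 (w - v) v) :=
  ((summable_theta 0 (w - v) hv).hasSum.mul_left _).congr_fun fun n => tripleTerm_exp w v n

theorem summable_tripleTerm {q z : ℂ} (hq0 : q ≠ 0) (hq : ‖q‖ < 1) (hz : z ≠ 0) :
    Summable (tripleTerm q z) := by
  have hv : (log q).re < 0 := by
    rw [log_re]
    exact Real.log_neg (norm_pos_iff.mpr hq0) hq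
  simpa [exp_log hq0, exp_log hz] using (hasSum_tripleTerm_exp (log z) hv).summable

/-- The Jacobi triple product identity. -/
theorem jacobi_triple_product {q z : ℂ} (hq0 : q ≠ 0) (hq : ‖q‖ < 1) (hz : z ≠ 0) :
    ∑' n : ℤ, tripleTerm q z n =
      (∏' i : ℕ, (1 - z * q ^ i)) * (∏' i : ℕ, (1 - q / z * q ^ i)) * euler q := by
  obtain ⟨K, hK⟩ := exists_norm_tripleCoeff_le hq
  have hne := euler_ne_zero hq
  have hlim : ∀ n : ℤ, Tendsto (fun N => tripleCoeff q N n * tripleTerm q z n) atTop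
      (𝓝 ((euler q)⁻¹ * tripleTerm q z n)) := by
    intro n
    have h1 := (tendsto_eulerFinite hq).comp (tendsto_id.const_mul_atTop' (Nat.succ_pos 1))
    have h2 := tendsto_eulerInv hq
      (tendsto_atTop_add_const_right atTop n (tendsto_natCast_atTop_atTop (R := ℤ)))
    have h3 := tendsto_eulerInv hq
      (tendsto_atTop_add_const_right atTop (-n) (tendsto_natCast_atTop_atTop (R := ℤ)))
    have h4 := (h1.mul (h2.mul h3)).mul_const (tripleTerm q z n)
    rw [mul_inv_cancel_left₀ hne] at h4
    exact h4
  have h := tendsto_tsum_of_dominated_convergence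
    ((summable_tripleTerm hq0 hq hz).norm.mul_left K) hlim (Eventually.of_forall fun N n => by
      rw [norm_mul]; gcongr; exact hK N n)
  simp only [(hasSum_finite_triple hq0 hq hz _).tsum_eq] at h
  have h' := (tendsto_prod_one_sub_mul_pow hq z).mul (tendsto_prod_one_sub_mul_pow hq (q / z))
  have e := tendsto_nhds_unique h h'
  rw [tsum_mul_left] at e
  rw [← e]
  field_simp

theorem continuous_tprod_one_sub_mul_pow {q : ℂ} (hq : ‖q‖ < 1) :
    Continuous fun z : ℂ => ∏' i : ℕ, (1 - z * q ^ i) := by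
  refine continuous_iff_continuousAt.mpr fun z => ?_
  have h := tendsto_tprod_one_add_of_dominated_convergence (𝓕 := 𝓝 z)
    (f := fun w (i : ℕ) => -(w * q ^ i)) (g := fun i : ℕ => -(z * q ^ i))
    (bound := fun i => (‖z‖ + 1) * ‖q ^ i‖)
    ((summable_geometric_of_norm_lt_one hq).norm.mul_left _)
    (fun i => (Continuous.tendsto (by fun_prop) z)) ?_
  · simpa only [ContinuousAt, sub_eq_add_neg] using h
  · filter_upwards [Metric.ball_mem_nhds z one_pos] with w hw i
    rw [norm_neg, norm_mul]
    gcongr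
    have := norm_add_le z (w - z)
    rw [add_sub_cancel] at this
    rw [mem_ball_iff_norm] at hw
    linarith

/-! ### Product formulas for theta -/

theorem norm_exp_lt_one {v : ℂ} (hv : v.re < 0) : ‖exp v‖ < 1 := by
  rw [norm_exp]
  exact Real.exp_lt_one_iff.mpr hv

theorem tsum_tripleTerm_exp (w : ℂ) {v : ℂ} (hv : v.re < 0) :
    ∑' n : ℤ, tripleTerm (exp v) (exp w) n = -exp (w / 2) * theta 0 w v := by
  have h := theta_zero_add_period (w - v) v
  rw [sub_add_cancel] at h
  rw [(hasSum_tripleTerm_exp w hv).tsum_eq, h, ← mul_assoc, neg_mul_neg, ← exp_add]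
  congr 2
  ring

/-- The factor vanishing at w = 0 is split off, so that θ'(0) can be read from the value of the
cofactor at 0. -/
theorem theta_zero_eq_prod (w : ℂ) {v : ℂ} (hv : v.re < 0) :
    theta 0 w v = (exp w - 1) * (exp (-(w / 2)) * (∏' i : ℕ, (1 - exp w * exp v * exp v ^ i)) *
      (∏' i : ℕ, (1 - exp v / exp w * exp v ^ i)) * euler (exp v)) := by
  have hq := norm_exp_lt_one hv
  have h := jacobi_triple_product (exp_ne_zero v) hq (exp_ne_zero w)
  have h0 : ∏' i : ℕ, (1 - exp w * exp v ^ i) =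
      (1 - exp w) * ∏' i : ℕ, (1 - exp w * exp v * exp v ^ i) := by
    have hm := multipliable_one_sub_mul_pow hq (exp w * exp v)
    rw [tprod_eq_zero_mul' (hm.congr fun i => by ring), pow_zero, mul_one]
    congr 1
    exact tprod_congr fun i => by ring
  rw [tsum_tripleTerm_exp w hv, h0] at h
  have e : exp (-(w / 2)) * exp (w / 2) = 1 := by rw [← exp_add]; simp
  linear_combination -exp (-(w / 2)) * h - theta 0 w v * e

/-- Jacobi's derivative formula `θ'(0) = (q;q)_∞³`. -/
theorem theta_one_zero {v : ℂ} (hv : v.re < 0) : theta 1 0 v = euler (exp v) ^ 3 := by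
  have hq := norm_exp_lt_one hv
  have hc := continuous_tprod_one_sub_mul_pow hq
  let K : ℂ → ℂ := fun w => exp (-(w / 2)) * (∏' i : ℕ, (1 - exp w * exp v * exp v ^ i)) *
      (∏' i : ℕ, (1 - exp v / exp w * exp v ^ i)) * euler (exp v)
  have hK : Continuous K := by
    have h1 := hc.comp (f := fun w => exp w * exp v) (by fun_prop)
    have h2 := hc.comp (f := fun w => exp v / exp w)
      (continuous_const.div continuous_exp exp_ne_zero)
    exact (((by fun_prop : Continuous fun w : ℂ => exp (-(w / 2))).mul h1).mul h2).mul_const _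
  -- The slope of θ at 0 is the slope of exp times `K`, so continuity of `K` suffices.
  have hd := hasDerivAt_iff_tendsto_slope.mp (hasDerivAt_exp 0)
  have h := hd.mul ((hK.tendsto 0).mono_left nhdsWithin_le_nhds)
  have hθ := hasDerivAt_iff_tendsto_slope.mp (hasDerivAt_theta_left 0 0 hv)
  have e := tendsto_nhds_unique hθ (h.congr fun w => by
    rw [slope_def_field, slope_def_field, theta_zero_zero, theta_zero_eq_prod w hv, exp_zero]
    ring)
  rw [zero_add] at e
  rw [e, euler_eq_tprod]
  simp only [K, exp_zero, zero_div, neg_zero, one_mul, div_one, euler_eq_tprod]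
  ring

/-- In the strip both exp w and exp(v - w) have modulus below 1, so no factor of the triple product
vanishes. -/
theorem theta_zero_ne_zero {w v : ℂ} (hv : v.re < 0) (h0 : w.re < 0) (h1 : v.re < w.re) :
    theta 0 w v ≠ 0 := by
  have hq := norm_exp_lt_one hv
  have hz := norm_exp_lt_one h0
  have aux : ∀ z : ℂ, ‖z‖ < 1 → ∏' i : ℕ, (1 - z * exp v ^ i) ≠ 0 := fun z hz =>
    tprod_one_sub_mul_pow_ne_zero hq fun i h => by
      have : ‖z * exp v ^ i‖ < 1 := by
        rw [norm_mul, norm_pow]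
        exact mul_lt_one_of_nonneg_of_lt_one_left (norm_nonneg _) hz
          (pow_le_one₀ (norm_nonneg _) hq.le)
      rw [← sub_eq_zero.mp h, norm_one] at this
      exact lt_irrefl _ this
  have h2 : ‖exp v / exp w‖ < 1 := by
    rw [← exp_sub]
    exact norm_exp_lt_one (by rw [sub_re]; linarith)
  have h := jacobi_triple_product (exp_ne_zero v) hq (exp_ne_zero w)
  rw [tsum_tripleTerm_exp w hv] at h
  intro h3
  rw [h3, mul_zero] at h
  exact mul_ne_zero (mul_ne_zero (aux _ hz) (aux _ h2)) (euler_ne_zero hq) h.symm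

/-- The five residue classes modulo five split `(q;q)_∞`. -/
theorem euler_eq_mul_mul {q : ℂ} (hq : ‖q‖ < 1) :
    euler q = ((∏' i : ℕ, (1 - q * (q ^ 5) ^ i)) * ∏' i : ℕ, (1 - q ^ 4 * (q ^ 5) ^ i)) *
      ((∏' i : ℕ, (1 - q ^ 2 * (q ^ 5) ^ i)) * ∏' i : ℕ, (1 - q ^ 3 * (q ^ 5) ^ i)) *
      euler (q ^ 5) := by
  have hq5 : ‖q ^ 5‖ < 1 := by
    rw [norm_pow]
    exact pow_lt_one₀ (norm_nonneg _) hq (by norm_num)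
  -- Along partial products of length 5N the splitting is exact.
  have h := (tendsto_eulerFinite hq).comp
    ((tendsto_id (α := ℕ)).const_mul_atTop' (Nat.succ_pos 4))
  have t := tendsto_prod_one_sub_mul_pow hq5
  have h' := (((t q).mul (t (q ^ 4))).mul ((t (q ^ 2)).mul (t (q ^ 3)))).mul
    (tendsto_eulerFinite hq5)
  refine tendsto_nhds_unique h (h'.congr fun N => ?_)
  simp only [Function.comp_apply, id]
  induction N with
  | zero => simp [eulerFinite]
  | succ N ih =>
    rw [show Nat.succ 4 * (N + 1) = Nat.succ 4 * N + 1 + 1 + 1 + 1 + 1 by ring,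
      eulerFinite_succ q, eulerFinite_succ q, eulerFinite_succ q, eulerFinite_succ q,
      eulerFinite_succ q, ← ih, eulerFinite_succ]
    simp only [Finset.prod_range_succ]
    ring

/-- The triple products with base q^5 at z = q and z = q² cover the residues ±1 and ±2 modulo 5;
with (q^5;q^5)_∞ they make up (q;q)_∞. This links the Euler product in A and B to theta values. -/
theorem theta_mul_theta {t : ℂ} (ht : t.re < 0) :
    exp (t / 2) * exp t * theta 0 t (5 * t) * theta 0 (2 * t) (5 * t) =
      euler (exp t) * euler (exp t ^ 5) := by
  have hv : (5 * t).re < 0 := by simp; linarith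
  have hq := norm_exp_lt_one ht
  have h5 : exp (5 * t) = exp t ^ 5 := by rw [← exp_nat_mul]; norm_num
  have h2 : exp (2 * t) = exp t ^ 2 := by rw [← exp_nat_mul]; norm_num
  have e1 := jacobi_triple_product (exp_ne_zero (5 * t)) (norm_exp_lt_one hv) (exp_ne_zero t)
  have e2 := jacobi_triple_product (exp_ne_zero (5 * t)) (norm_exp_lt_one hv)
    (exp_ne_zero (2 * t))
  rw [tsum_tripleTerm_exp _ hv, h5, show exp t ^ 5 / exp t = exp t ^ 4 by
    field_simp [exp_ne_zero]] at e1
  rw [tsum_tripleTerm_exp _ hv, h5, h2, show exp t ^ 5 / exp t ^ 2 = exp t ^ 3 by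
    field_simp [exp_ne_zero], show 2 * t / 2 = t by ring] at e2
  rw [euler_eq_mul_mul hq]
  linear_combination (-exp t * theta 0 (2 * t) (5 * t)) * e1 +
    ((∏' i : ℕ, (1 - exp t * (exp t ^ 5) ^ i)) * (∏' i : ℕ, (1 - exp t ^ 4 * (exp t ^ 5) ^ i)) *
      euler (exp t ^ 5)) * e2

/-! ### The logarithm of the Euler product and E₂ -/

/-- The logarithm of `(q;q)_∞` that vanishes at `q = 0`. -/
noncomputable def logEuler (q : ℂ) : ℂ := ∑' n : ℕ, log (1 - q ^ (n + 1))

theorem one_sub_pow_mem_slitPlane {q : ℂ} (hq : ‖q‖ < 1) (n : ℕ) :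
    1 - q ^ (n + 1) ∈ slitPlane := by
  have h1 : ‖q ^ (n + 1)‖ < 1 := by
    rw [norm_pow]
    exact pow_lt_one₀ (norm_nonneg _) hq n.succ_ne_zero
  refine Or.inl ?_
  rw [sub_re, one_re]
  linarith [re_le_norm (q ^ (n + 1))]

theorem hasDerivAt_log_one_sub_pow {q : ℂ} (hq : ‖q‖ < 1) (n : ℕ) :
    HasDerivAt (fun q => log (1 - q ^ (n + 1))) (-((n + 1) * q ^ n) / (1 - q ^ (n + 1))) q := by
  have h := ((hasDerivAt_pow (n + 1) q).const_sub 1).clog (one_sub_pow_mem_slitPlane hq n)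
  simpa using h

theorem tsum_lambert_eq_E₂ {q : ℂ} (hq : ‖q‖ < 1) :
    ∑' n : ℕ, ((n : ℂ) + 1) * q ^ (n + 1) / (1 - q ^ (n + 1)) = (1 - E₂ q) / 24 := by
  have h := tsum_pow_div_one_sub_eq_tsum_sigma hq 1
  have h1 := tsum_pnat_eq_tsum_succ (f := fun n : ℕ => (n : ℂ) * q ^ n / (1 - q ^ n))
  simp only [pow_one] at h
  rw [h] at h1
  push_cast at h1
  rw [← h1, E₂]
  simp only [ArithmeticFunction.sigma_one_apply]
  push_cast
  ring

theorem exists_hasDerivAt_logEuler {q : ℂ} (hq : ‖q‖ < 1) :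
    ∃ d, HasDerivAt logEuler d q ∧ q * d = (E₂ q - 1) / 24 := by
  obtain ⟨ρ, hqρ, hρ⟩ := exists_between hq
  have hρ0 : 0 ≤ ρ := (norm_nonneg q).trans hqρ.le
  let U : Set ℂ := Metric.ball 0 ρ
  have hU : ∀ w ∈ U, ‖w‖ < ρ := fun w hw => by simpa [U] using hw
  have hqU : q ∈ U := by simpa [U] using hqρ
  -- The constant comes from |log(1 + z)| ≤ |z|²(1 - |z|)⁻¹/2 + |z| with |z| ≤ ρ^(n+1) ≤ ρ.
  have hsum : Summable fun n : ℕ => ρ ^ (n + 1) * ((1 - ρ)⁻¹ / 2 + 1) :=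
    ((summable_nat_add_iff 1).mpr (summable_geometric_of_lt_one hρ0 hρ)).mul_right _
  have hd : ∀ n : ℕ, DifferentiableOn ℂ (fun w : ℂ => log (1 - w ^ (n + 1))) U :=
    fun n w hw => (hasDerivAt_log_one_sub_pow ((hU w hw).trans hρ)
      n).differentiableAt.differentiableWithinAt
  have hb : ∀ (n : ℕ) (w : ℂ), w ∈ U →
      ‖log (1 - w ^ (n + 1))‖ ≤ ρ ^ (n + 1) * ((1 - ρ)⁻¹ / 2 + 1) := by
    intro n w hw
    have h1 : ‖w ^ (n + 1)‖ ≤ ρ ^ (n + 1) := by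
      rw [norm_pow]
      exact pow_le_pow_left₀ (norm_nonneg _) (hU w hw).le _
    have h2 : ρ ^ (n + 1) ≤ ρ := pow_le_of_le_one hρ0 hρ.le n.succ_ne_zero
    have h3 : ‖-w ^ (n + 1)‖ < 1 := by rw [norm_neg]; linarith
    have h4 := norm_log_one_add_le h3
    rw [norm_neg, ← sub_eq_add_neg] at h4
    refine h4.trans ?_
    have h5 : (1 - ‖w ^ (n + 1)‖)⁻¹ ≤ (1 - ρ)⁻¹ := by
      apply inv_anti₀ <;> linarith
    have h6 : ‖w ^ (n + 1)‖ ^ 2 ≤ ρ ^ (n + 1) := by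
      rw [sq]
      have : ‖w ^ (n + 1)‖ ≤ 1 := by linarith
      nlinarith [norm_nonneg (w ^ (n + 1))]
    have h7 : 0 ≤ (1 - ‖w ^ (n + 1)‖)⁻¹ := inv_nonneg.mpr (by linarith)
    have h8 := mul_le_mul h6 h5 h7 (by positivity)
    linarith
  have hdiff := (differentiableOn_tsum_of_summable_norm hsum hd Metric.isOpen_ball
    hb).differentiableAt (Metric.isOpen_ball.mem_nhds hqU)
  have hs := hasSum_deriv_of_summable_norm hsum hd Metric.isOpen_ball hb hqU
  refine ⟨_, hdiff.hasDerivAt, ?_⟩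
  rw [← hs.tsum_eq, ← tsum_mul_left]
  have h := tsum_lambert_eq_E₂ hq
  rw [show (E₂ q - 1) / 24 = -((1 - E₂ q) / 24) by ring, ← h, ← tsum_neg]
  refine tsum_congr fun n => ?_
  rw [(hasDerivAt_log_one_sub_pow hq n).deriv]
  ring

theorem exp_logEuler {q : ℂ} (hq : ‖q‖ < 1) : exp (logEuler q) = euler q := by
  rw [← eulerPow_one hq, eulerPow, one_mul, logEuler]

theorem hasDerivAt_logEuler_exp (a : ℂ) {t : ℂ} (ht : (a * t).re < 0) :
    HasDerivAt (fun t => logEuler (exp (a * t))) (a * ((E₂ (exp (a * t)) - 1) / 24)) t := by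
  obtain ⟨d, hd, he⟩ := exists_hasDerivAt_logEuler (norm_exp_lt_one ht)
  have h := hd.comp t (((hasDerivAt_id t).const_mul a).cexp)
  refine h.congr_deriv ?_
  rw [← he]
  simp only [id, mul_one]
  ring

/-- A function is differentiable at `exp t` as soon as its composition with `exp` is at `t`. -/
theorem hasDerivAt_of_comp_exp {f : ℂ → ℂ} {d t : ℂ}
    (h : HasDerivAt (fun w => f (exp w)) d t) : HasDerivAt f (d / exp t) (exp t) := by
  have hs := hasStrictDerivAt_exp t
  have hg := (hs.to_localInverse (exp_ne_zero t)).hasDerivAt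
  have hr := hs.eventually_right_inverse (exp_ne_zero t)
  have hl : hs.localInverse _ _ _ (exp_ne_zero t) (exp t) = t :=
    (hs.eventually_left_inverse (exp_ne_zero t)).self_of_nhds
  have h1 : HasDerivAt (fun w => f (exp w)) d
      (hs.localInverse _ _ _ (exp_ne_zero t) (exp t)) := by rwa [hl]
  refine ((h1.comp (exp t) hg).congr_of_eventuallyEq ?_).congr_deriv (div_eq_mul_inv _ _).symm
  filter_upwards [hr] with w hw
  exact (congrArg f hw).symm

/-! ### Theta at the 5-torsion points -/

/-- The theta series and its derivatives at the torsion point `u = t`, with `v = 5 t`. -/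
noncomputable def thetaA (k : ℕ) (t : ℂ) : ℂ := theta k t (5 * t)

/-- The theta series and its derivatives at the torsion point `u = 2 t`, with `v = 5 t`. -/
noncomputable def thetaB (k : ℕ) (t : ℂ) : ℂ := theta k (2 * t) (5 * t)

/-- The normalized logarithmic derivative of `θ` at `u = t`. -/
noncomputable def zetaA (t : ℂ) : ℂ := thetaA 1 t / thetaA 0 t + 1 / 5

/-- The shifts 1/5 and 2/5 are u/v: θ'/θ drops by 1 under u ↦ u + v, so θ'/θ + u/v is v-periodic.
They also complete the square in `hasDerivAt_thetaA_zero` and `hasDerivAt_thetaB_zero`. -/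
noncomputable def zetaB (t : ℂ) : ℂ := thetaB 1 t / thetaB 0 t + 2 / 5

/-- The second logarithmic derivative of `θ` at `u = t`. -/
noncomputable def curvA (t : ℂ) : ℂ := hess t (5 * t) / thetaA 0 t ^ 2

noncomputable def curvB (t : ℂ) : ℂ := hess (2 * t) (5 * t) / thetaB 0 t ^ 2

noncomputable def alpha (t : ℂ) : ℂ :=
  theta 1 0 (5 * t) * thetaA 0 t ^ 2 / (exp (t / 2) ^ 2 * thetaB 0 t ^ 3)

noncomputable def beta (t : ℂ) : ℂ :=
  exp (t / 2) * theta 1 0 (5 * t) * thetaB 0 t ^ 2 / thetaA 0 t ^ 3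

theorem five_mul_re_neg {t : ℂ} (ht : t.re < 0) : (5 * t).re < 0 := by simp; linarith

theorem thetaA_ne_zero {t : ℂ} (ht : t.re < 0) : thetaA 0 t ≠ 0 :=
  theta_zero_ne_zero (five_mul_re_neg ht) ht (by simp; linarith)

theorem thetaB_ne_zero {t : ℂ} (ht : t.re < 0) : thetaB 0 t ≠ 0 :=
  theta_zero_ne_zero (five_mul_re_neg ht) (by simp; linarith) (by simp; linarith)

theorem theta_one_zero_ne_zero {t : ℂ} (ht : t.re < 0) : theta 1 0 (5 * t) ≠ 0 := by
  rw [theta_one_zero (five_mul_re_neg ht)]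
  exact pow_ne_zero 3 (euler_ne_zero (norm_exp_lt_one (five_mul_re_neg ht)))

theorem alpha_ne_zero {t : ℂ} (ht : t.re < 0) : alpha t ≠ 0 :=
  div_ne_zero (mul_ne_zero (theta_one_zero_ne_zero ht) (pow_ne_zero 2 (thetaA_ne_zero ht)))
    (mul_ne_zero (pow_ne_zero 2 (exp_ne_zero _)) (pow_ne_zero 3 (thetaB_ne_zero ht)))

theorem beta_ne_zero {t : ℂ} (ht : t.re < 0) : beta t ≠ 0 :=
  div_ne_zero (mul_ne_zero (mul_ne_zero (exp_ne_zero _) (theta_one_zero_ne_zero ht))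
    (pow_ne_zero 2 (thetaB_ne_zero ht))) (pow_ne_zero 3 (thetaA_ne_zero ht))

theorem exp_half_sq (t : ℂ) : exp (t / 2) ^ 2 = exp t := by
  rw [← exp_nat_mul]
  congr 1
  push_cast
  ring

/-- Because 3t = 5t - 2t, quasi-periodicity and oddness return to the point 2t. -/
theorem theta_three (t : ℂ) : theta 0 (2 * t + t) (5 * t) = (exp (t / 2))⁻¹ * thetaB 0 t := by
  have h := theta_zero_add_period (-(2 * t)) (5 * t)
  rw [theta_neg, show -(2 * t) + 5 * t = 2 * t + t by ring,
    show -(-(2 * t)) - 5 * t / 2 = -(t / 2) by ring, exp_neg] at h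
  rw [h, thetaB]
  ring

theorem theta_one_three {t : ℂ} (ht : t.re < 0) :
    theta 1 (2 * t + t) (5 * t) = -(exp (t / 2))⁻¹ * (thetaB 1 t + thetaB 0 t) := by
  have h := theta_one_add_period (-(2 * t)) (five_mul_re_neg ht)
  rw [theta_neg, theta_neg, show -(2 * t) + 5 * t = 2 * t + t by ring,
    show -(-(2 * t)) - 5 * t / 2 = -(t / 2) by ring, exp_neg] at h
  rw [h, thetaB, thetaB]
  ring

theorem theta_four (t : ℂ) :
    theta 0 (2 * (2 * t)) (5 * t) = (exp (t / 2) ^ 3)⁻¹ * thetaA 0 t := by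
  have h := theta_zero_add_period (-t) (5 * t)
  rw [theta_neg, show -t + 5 * t = 2 * (2 * t) by ring,
    show -(-t) - 5 * t / 2 = -((3 : ℕ) * (t / 2)) by push_cast; ring, exp_neg, exp_nat_mul] at h
  rw [h, thetaA]
  ring

/-- This is `hess_sub_hess` at (2t, t): the sum 3t folds back to 2t and the difference is t. -/
theorem curvB_sub_curvA {t : ℂ} (ht : t.re < 0) : curvB t - curvA t = alpha t * beta t := by
  have h := hess_sub_hess (2 * t) t (five_mul_re_neg ht)
  rw [theta_three, show 2 * t - t = t by ring] at h
  have hA := thetaA_ne_zero ht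
  have hB := thetaB_ne_zero ht
  have hs := exp_ne_zero (t / 2)
  rw [curvB, curvA, alpha, beta]
  simp only [thetaA, thetaB] at *
  generalize theta 0 (2 * t) (5 * t) = b₀ at *
  generalize hess (2 * t) (5 * t) = H at *
  field_simp at h ⊢
  linear_combination -h

/-- Duplication at t leads to 2t; in `hess'_eq_right` duplication at 2t leads to 4t, which folds
back to t. So third derivatives of θ reduce to lower ones. -/
theorem hess'_eq_left {t : ℂ} (ht : t.re < 0) :
    hess' t (5 * t) = thetaA 0 t ^ 2 *
      (alpha t * beta t ^ 2 + 2 * curvA t * (zetaA t - 1 / 5)) := by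
  have h := theta_two_mul t (five_mul_re_neg ht)
  have hA := thetaA_ne_zero ht
  have hB := thetaB_ne_zero ht
  have hs := exp_ne_zero (t / 2)
  rw [curvA, alpha, beta, zetaA]
  simp only [thetaA, thetaB] at *
  generalize theta 0 (2 * t) (5 * t) = b₀ at *
  field_simp
  linear_combination 5 * h

theorem hess'_eq_right {t : ℂ} (ht : t.re < 0) :
    hess' (2 * t) (5 * t) = thetaB 0 t ^ 2 *
      (alpha t ^ 2 * beta t + 2 * curvB t * (zetaB t - 2 / 5)) := by
  have h := theta_two_mul (2 * t) (five_mul_re_neg ht)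
  rw [theta_four] at h
  have hA := thetaA_ne_zero ht
  have hB := thetaB_ne_zero ht
  have hs := exp_ne_zero (t / 2)
  rw [curvB, alpha, beta, zetaB]
  simp only [thetaA, thetaB] at *
  generalize theta 0 (2 * t) (5 * t) = b₀ at *
  generalize theta 1 (2 * t) (5 * t) = b₁ at *
  generalize hess (2 * t) (5 * t) = H at *
  generalize hess' (2 * t) (5 * t) = H' at *
  field_simp at h ⊢
  linear_combination 5 * h

theorem hess''_eq {t : ℂ} (ht : t.re < 0) :
    hess'' t (5 * t) = thetaA 0 t ^ 2 *
      (2 * curvA t * (2 * (zetaA t - 1 / 5) ^ 2 + curvA t) +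
        2 * alpha t * beta t ^ 2 * (zetaB t - 2 / 5)) := by
  have h := theta_two_mul_deriv t (five_mul_re_neg ht)
  have hA := thetaA_ne_zero ht
  have hB := thetaB_ne_zero ht
  have hs := exp_ne_zero (t / 2)
  rw [curvA, alpha, beta, zetaA, zetaB]
  simp only [thetaA, thetaB, hess] at *
  generalize theta 0 (2 * t) (5 * t) = b₀ at *
  generalize theta 1 (2 * t) (5 * t) = b₁ at *
  field_simp at h ⊢
  linear_combination 25 * h

/-- The a-derivative of `hess_sub_hess` at (2t, t) has third-order terms only through `hess'` at 2t,
which duplication removes. What remains is divisible by `alpha t * beta t`. For `beta_eq` the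
b-derivative plays this part. -/
theorem alpha_eq {t : ℂ} (ht : t.re < 0) : zetaA t - 3 * zetaB t = alpha t := by
  have h := hess_sub_hess_deriv_left (2 * t) t (five_mul_re_neg ht)
  have hc := curvB_sub_curvA ht
  have hA := thetaA_ne_zero ht
  have hB := thetaB_ne_zero ht
  have hs := exp_ne_zero (t / 2)
  rw [hess'_eq_right ht, theta_three, theta_one_three ht, show 2 * t - t = t by ring] at h
  have e1 : hess t (5 * t) = curvA t * thetaA 0 t ^ 2 := by
    rw [curvA]; field_simp
  have e2 : theta 1 t (5 * t) = (zetaA t - 1 / 5) * thetaA 0 t := by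
    rw [zetaA, thetaA]; field_simp; ring
  have e3 : thetaB 1 t = (zetaB t - 2 / 5) * thetaB 0 t := by
    rw [zetaB]; field_simp; ring
  have e4 : theta 1 0 (5 * t) ^ 2 * (exp (t / 2))⁻¹ =
      alpha t * beta t * (thetaA 0 t * thetaB 0 t) := by
    rw [alpha, beta]; field_simp
  have h2 : theta 1 (2 * t) (5 * t) = thetaB 1 t := rfl
  have h3 : theta 0 (2 * t) (5 * t) = thetaB 0 t := rfl
  have h4 : theta 0 t (5 * t) = thetaA 0 t := rfl
  rw [e1, h2, h3, e2, e3, h4] at h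
  have hab : alpha t * beta t * (thetaA 0 t ^ 2 * thetaB 0 t ^ 2) ≠ 0 :=
    mul_ne_zero (mul_ne_zero (alpha_ne_zero ht) (beta_ne_zero ht))
      (mul_ne_zero (pow_ne_zero 2 hA) (pow_ne_zero 2 hB))
  refine mul_left_cancel₀ hab ?_
  linear_combination h - (thetaA 0 t * thetaB 0 t) *
    (zetaA t - zetaB t - 4 / 5) * e4 +
    2 * thetaA 0 t ^ 2 * thetaB 0 t ^ 2 * (zetaB t - 2 / 5) * hc

theorem beta_eq {t : ℂ} (ht : t.re < 0) : 3 * zetaA t + zetaB t = beta t := by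
  have h := hess_sub_hess_deriv_right (2 * t) t (five_mul_re_neg ht)
  have hc := curvB_sub_curvA ht
  have hA := thetaA_ne_zero ht
  have hB := thetaB_ne_zero ht
  have hs := exp_ne_zero (t / 2)
  rw [hess'_eq_left ht, theta_three, theta_one_three ht, show 2 * t - t = t by ring] at h
  have e1 : hess (2 * t) (5 * t) = curvB t * thetaB 0 t ^ 2 := by
    rw [curvB]; field_simp
  have e2 : theta 1 t (5 * t) = (zetaA t - 1 / 5) * thetaA 0 t := by
    rw [zetaA, thetaA]; field_simp; ring
  have e3 : thetaB 1 t = (zetaB t - 2 / 5) * thetaB 0 t := by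
    rw [zetaB]; field_simp; ring
  have e4 : theta 1 0 (5 * t) ^ 2 * (exp (t / 2))⁻¹ =
      alpha t * beta t * (thetaA 0 t * thetaB 0 t) := by
    rw [alpha, beta]; field_simp
  have h3 : theta 0 (2 * t) (5 * t) = thetaB 0 t := rfl
  have h4 : theta 0 t (5 * t) = thetaA 0 t := rfl
  rw [e1, h3, e2, e3, h4] at h
  have hab : alpha t * beta t * (thetaA 0 t ^ 2 * thetaB 0 t ^ 2) ≠ 0 :=
    mul_ne_zero (mul_ne_zero (alpha_ne_zero ht) (beta_ne_zero ht))
      (mul_ne_zero (pow_ne_zero 2 hA) (pow_ne_zero 2 hB))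
  refine mul_left_cancel₀ hab ?_
  linear_combination -h - (thetaA 0 t * thetaB 0 t) *
    (zetaA t + zetaB t + 2 / 5) * e4 -
    2 * thetaA 0 t ^ 2 * thetaB 0 t ^ 2 * (zetaA t - 1 / 5) * hc

theorem zetaA_eq {t : ℂ} (ht : t.re < 0) : zetaA t = (3 * beta t + alpha t) / 10 := by
  linear_combination (3 * beta_eq ht + alpha_eq ht) / 10

theorem zetaB_eq {t : ℂ} (ht : t.re < 0) : zetaB t = (beta t - 3 * alpha t) / 10 := by
  linear_combination (beta_eq ht - 3 * alpha_eq ht) / 10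

/-! ### Differential equations in t -/

theorem hasDerivAt_thetaA {t : ℂ} (k : ℕ) (ht : t.re < 0) :
    HasDerivAt (thetaA k)
      (thetaA (k + 1) t + 5 / 2 * (thetaA (k + 2) t - thetaA k t / 4)) t := by
  have h := hasDerivAt_theta_affine k 0 0 1 5 t (by simpa using five_mul_re_neg ht)
  simp only [zero_add, one_mul] at h
  exact h

theorem hasDerivAt_thetaB {t : ℂ} (k : ℕ) (ht : t.re < 0) :
    HasDerivAt (thetaB k)
      (2 * thetaB (k + 1) t + 5 / 2 * (thetaB (k + 2) t - thetaB k t / 4)) t := by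
  have h := hasDerivAt_theta_affine k 0 0 2 5 t (by simpa using five_mul_re_neg ht)
  simp only [zero_add] at h
  exact h

theorem hasDerivAt_thetaA_zero {t : ℂ} (ht : t.re < 0) :
    HasDerivAt (thetaA 0) (thetaA 0 t * (5 / 2 * (curvA t + zetaA t ^ 2) - 29 / 40)) t := by
  refine (hasDerivAt_thetaA 0 ht).congr_deriv ?_
  have hA := thetaA_ne_zero ht
  rw [curvA, zetaA, hess]
  simp only [thetaA] at *
  field_simp
  ring

theorem hasDerivAt_thetaB_zero {t : ℂ} (ht : t.re < 0) :
    HasDerivAt (thetaB 0) (thetaB 0 t * (5 / 2 * (curvB t + zetaB t ^ 2) - 41 / 40)) t := by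
  refine (hasDerivAt_thetaB 0 ht).congr_deriv ?_
  have hB := thetaB_ne_zero ht
  rw [curvB, zetaB, hess]
  simp only [thetaB] at *
  generalize theta 0 (2 * t) (5 * t) = b₀ at *
  generalize theta 1 (2 * t) (5 * t) = b₁ at *
  generalize theta 2 (2 * t) (5 * t) = b₂ at *
  field_simp
  ring

theorem hasDerivAt_zetaA {t : ℂ} (ht : t.re < 0) :
    HasDerivAt zetaA (5 / 2 * (alpha t * beta t ^ 2) + 5 * curvA t * zetaA t) t := by
  have hA := thetaA_ne_zero ht
  have h := ((hasDerivAt_thetaA 1 ht).fun_div (hasDerivAt_thetaA 0 ht) hA).add_const (1 / 5 : ℂ)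
  refine h.congr_deriv ?_
  have e : alpha t * beta t ^ 2 =
      hess' t (5 * t) / thetaA 0 t ^ 2 - 2 * curvA t * (zetaA t - 1 / 5) := by
    rw [hess'_eq_left ht]; field_simp; ring
  rw [e, curvA, zetaA, hess, hess']
  simp only [thetaA] at *
  field_simp
  ring

theorem hasDerivAt_zetaB {t : ℂ} (ht : t.re < 0) :
    HasDerivAt zetaB (5 / 2 * (alpha t ^ 2 * beta t) + 5 * curvB t * zetaB t) t := by
  have hB := thetaB_ne_zero ht
  have h := ((hasDerivAt_thetaB 1 ht).fun_div (hasDerivAt_thetaB 0 ht) hB).add_const (2 / 5 : ℂ)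
  refine h.congr_deriv ?_
  have e : alpha t ^ 2 * beta t =
      hess' (2 * t) (5 * t) / thetaB 0 t ^ 2 - 2 * curvB t * (zetaB t - 2 / 5) := by
    rw [hess'_eq_right ht]; field_simp; ring
  rw [e, curvB, zetaB, hess, hess']
  simp only [thetaB] at *
  generalize theta 0 (2 * t) (5 * t) = b₀ at *
  generalize theta 1 (2 * t) (5 * t) = b₁ at *
  generalize theta 2 (2 * t) (5 * t) = b₂ at *
  field_simp
  ring

theorem hasDerivAt_curvA {t : ℂ} (ht : t.re < 0) :
    HasDerivAt curvA (5 * curvA t ^ 2 + 5 * (alpha t * beta t ^ 2) * (zetaB t - zetaA t)) t := by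
  have hA := thetaA_ne_zero ht
  have h := (((hasDerivAt_thetaA 0 ht).fun_mul (hasDerivAt_thetaA 2 ht)).fun_sub
    ((hasDerivAt_thetaA 1 ht).fun_pow 2)).fun_div ((hasDerivAt_thetaA 0 ht).fun_pow 2)
    (pow_ne_zero 2 hA)
  refine h.congr_deriv ?_
  have e1 := hess'_eq_left ht
  have e2 := hess''_eq ht
  have e3 : curvA t * thetaA 0 t ^ 2 = thetaA 0 t * thetaA 2 t - thetaA 1 t ^ 2 := by
    rw [curvA]; field_simp; rfl
  have e4 : thetaA 1 t = (zetaA t - 1 / 5) * thetaA 0 t := by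
    rw [zetaA]; field_simp; ring
  rw [hess'] at e1
  rw [hess''] at e2
  change thetaA 0 t * thetaA 3 t - thetaA 1 t * thetaA 2 t = _ at e1
  change thetaA 0 t * thetaA 4 t - thetaA 2 t ^ 2 = _ at e2
  rw [e4] at e1 e3 ⊢
  -- The second, third and fourth derivatives of θ at t are solved for in turn from `hess`, `hess'`
  -- and `hess''`.
  have e5 : thetaA 2 t = thetaA 0 t * (curvA t + (zetaA t - 1 / 5) ^ 2) := by
    refine mul_left_cancel₀ hA ?_
    linear_combination -e3
  rw [e5] at e1 e2 ⊢
  have e6 : thetaA 3 t = thetaA 0 t * (alpha t * beta t ^ 2 + 2 * curvA t * (zetaA t - 1 / 5) +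
      (zetaA t - 1 / 5) * (curvA t + (zetaA t - 1 / 5) ^ 2)) := by
    refine mul_left_cancel₀ hA ?_
    linear_combination e1
  have e7 : thetaA 4 t = thetaA 0 t * (2 * curvA t * (2 * (zetaA t - 1 / 5) ^ 2 + curvA t) +
        2 * alpha t * beta t ^ 2 * (zetaB t - 2 / 5) +
        (curvA t + (zetaA t - 1 / 5) ^ 2) ^ 2) := by
    refine mul_left_cancel₀ hA ?_
    linear_combination e2
  norm_num
  rw [e7, e6]
  field_simp
  ring

theorem hasDerivAt_theta_one_zero {t : ℂ} (ht : t.re < 0) :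
    HasDerivAt (fun t => theta 1 0 (5 * t))
      (theta 1 0 (5 * t) * (5 / 8 * (P (exp t) - 1))) t := by
  have h := ((hasDerivAt_logEuler_exp 5 (five_mul_re_neg ht)).const_mul 3).cexp
  have e : ∀ w : ℂ, w.re < 0 → theta 1 0 (5 * w) = exp (3 * logEuler (exp (5 * w))) := by
    intro w hw
    have h5 := five_mul_re_neg hw
    rw [theta_one_zero h5, ← exp_logEuler (norm_exp_lt_one h5), ← exp_nat_mul]
    norm_num
  have h5 : exp (5 * t) = exp t ^ 5 := by rw [← exp_nat_mul]; norm_num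
  refine (h.congr_of_eventuallyEq ?_).congr_deriv ?_
  · filter_upwards [(isOpen_lt continuous_re continuous_const).mem_nhds ht] with w hw
    exact e w hw
  · rw [← e t ht, P, h5]
    ring

theorem hasDerivAt_beta {t : ℂ} (ht : t.re < 0) :
    HasDerivAt beta (15 / 2 * (alpha t * beta t ^ 2) + 5 / 2 * (alpha t ^ 2 * beta t) +
      15 * curvA t * zetaA t + 5 * curvB t * zetaB t) t := by
  have h := ((hasDerivAt_zetaA ht).const_mul 3).fun_add (hasDerivAt_zetaB ht)
  refine (h.congr_of_eventuallyEq ?_).congr_deriv (by ring)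
  filter_upwards [(isOpen_lt continuous_re continuous_const).mem_nhds ht] with w hw
  exact (beta_eq hw).symm

theorem hasDerivAt_alpha {t : ℂ} (ht : t.re < 0) :
    HasDerivAt alpha (5 / 2 * (alpha t * beta t ^ 2) - 15 / 2 * (alpha t ^ 2 * beta t) +
      5 * curvA t * zetaA t - 15 * curvB t * zetaB t) t := by
  have h := (hasDerivAt_zetaA ht).fun_sub ((hasDerivAt_zetaB ht).const_mul 3)
  refine (h.congr_of_eventuallyEq ?_).congr_deriv (by ring)
  filter_upwards [(isOpen_lt continuous_re continuous_const).mem_nhds ht] with w hw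
  exact (alpha_eq hw).symm

/-- The derivative of the monomial `beta` contains 𝒫 through θ'(0); that of 3 `zetaA` + `zetaB` does
not. Equating them leaves a linear equation for `curvA`. -/
theorem curvA_eq {t : ℂ} (ht : t.re < 0) :
    curvA t = (P (exp t) - (beta t ^ 2 + 6 * alpha t * beta t + alpha t ^ 2)) / 12 := by
  have hA := thetaA_ne_zero ht
  have hs : HasDerivAt (fun t : ℂ => exp (t / 2)) (exp (t / 2) * (1 / 2)) t := by
    simpa using ((hasDerivAt_id t).div_const 2).cexp
  have h := ((hs.fun_mul (hasDerivAt_theta_one_zero ht)).fun_mul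
    ((hasDerivAt_thetaB_zero ht).fun_pow 2)).fun_div ((hasDerivAt_thetaA_zero ht).fun_pow 3)
    (pow_ne_zero 3 hA)
  have h2 : HasDerivAt beta (beta t * (1 / 2 + 5 / 8 * (P (exp t) - 1) +
      2 * (5 / 2 * (curvB t + zetaB t ^ 2) - 41 / 40) -
      3 * (5 / 2 * (curvA t + zetaA t ^ 2) - 29 / 40))) t := by
    refine h.congr_deriv ?_
    rw [beta]
    norm_num
    field_simp
  have e := h2.unique (hasDerivAt_beta ht)
  have hc : curvB t = curvA t + alpha t * beta t := by
    linear_combination curvB_sub_curvA ht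
  rw [hc, zetaA_eq ht, zetaB_eq ht] at e
  refine mul_left_cancel₀ (beta_ne_zero ht) ?_
  linear_combination -2 / 15 * e

/-- Solving `curvA_eq` for 𝒫 shows both its differentiability and its derivative. -/
theorem hasDerivAt_P_exp {t : ℂ} (ht : t.re < 0) :
    HasDerivAt (fun t => P (exp t)) (5 / 12 * (P (exp t) ^ 2 - beta t ^ 4 +
      12 * beta t ^ 3 * alpha t - 14 * beta t ^ 2 * alpha t ^ 2 - 12 * beta t * alpha t ^ 3 -
      alpha t ^ 4)) t := by
  have h := ((hasDerivAt_curvA ht).const_mul 12).fun_add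
    ((((hasDerivAt_beta ht).fun_pow 2).fun_add
    (((hasDerivAt_alpha ht).const_mul 6).fun_mul (hasDerivAt_beta ht))).fun_add
      ((hasDerivAt_alpha ht).fun_pow 2))
  refine (h.congr_of_eventuallyEq ?_).congr_deriv ?_
  · filter_upwards [(isOpen_lt continuous_re continuous_const).mem_nhds ht] with w hw
    rw [curvA_eq hw]
    ring
  · have hc : curvB t = curvA t + alpha t * beta t := by
      linear_combination curvB_sub_curvA ht
    rw [hc, zetaA_eq ht, zetaB_eq ht, curvA_eq ht]
    norm_num
    ring

/-- The logarithmic derivative of `theta_mul_theta`; it removes E₂(q), which enters through the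
power (q;q)_∞^(-3/5). -/
theorem logEuler_deriv_eq {t : ℂ} (ht : t.re < 0) :
    (E₂ (exp t) - 1) / 24 = 3 / 2 + (5 / 2 * (curvA t + zetaA t ^ 2) - 29 / 40) +
      (5 / 2 * (curvB t + zetaB t ^ 2) - 41 / 40) - 5 / 24 * (P (exp t) - 1) := by
  have h5 : exp (5 * t) = exp t ^ 5 := by rw [← exp_nat_mul]; norm_num
  have e : ∀ w : ℂ, w.re < 0 → exp (logEuler (exp (1 * w)) + logEuler (exp (5 * w))) =
      exp (3 / 2 * w) * thetaA 0 w * thetaB 0 w := by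
    intro w hw
    have h5 : exp (5 * w) = exp w ^ 5 := by rw [← exp_nat_mul]; norm_num
    rw [exp_add, one_mul, exp_logEuler (norm_exp_lt_one hw),
      exp_logEuler (norm_exp_lt_one (five_mul_re_neg hw)), h5, ← theta_mul_theta hw, ← exp_add,
      thetaA, thetaB]
    ring_nf
  have h1 := ((hasDerivAt_logEuler_exp 1 (by simpa using ht)).fun_add
    (hasDerivAt_logEuler_exp 5 (five_mul_re_neg ht))).cexp
  have hs : HasDerivAt (fun t : ℂ => exp (3 / 2 * t)) (exp (3 / 2 * t) * (3 / 2)) t := by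
    simpa using ((hasDerivAt_id t).const_mul (3 / 2)).cexp
  have h2 := (hs.fun_mul (hasDerivAt_thetaA_zero ht)).fun_mul (hasDerivAt_thetaB_zero ht)
  have h3 := h2.unique (h1.congr_of_eventuallyEq (by
    filter_upwards [(isOpen_lt continuous_re continuous_const).mem_nhds ht] with w hw
    exact (e w hw).symm))
  rw [e t ht, h5] at h3
  simp only [one_mul] at h3
  have hne : exp (3 / 2 * t) * thetaA 0 t * thetaB 0 t ≠ 0 :=
    mul_ne_zero (mul_ne_zero (exp_ne_zero _) (thetaA_ne_zero ht)) (thetaB_ne_zero ht)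
  refine mul_left_cancel₀ hne ?_
  rw [P]
  linear_combination -h3

/-! ### Return to A and B -/

theorem tsum_A_exp {t : ℂ} (ht : t.re < 0) :
    ∑' n : ℤ, (-1 : ℂ) ^ n * exp t ^ ((5 * n ^ 2 - 3 * n) / 2) = -exp (t / 2) * thetaA 0 t := by
  rw [thetaA, ← tsum_tripleTerm_exp t (five_mul_re_neg ht)]
  refine tsum_congr fun n => ?_
  obtain ⟨m, hm⟩ : Even (n * (n - 1)) := Int.even_mul_pred_self n
  have h1 : n * (n - 1) / 2 = m := by omega
  have h2 : (5 * n ^ 2 - 3 * n) / 2 = 5 * m + n := by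
    rw [show 5 * n ^ 2 - 3 * n = 5 * (n * (n - 1)) + 2 * n by ring]
    omega
  have h5 : exp (5 * t) = exp t ^ (5 : ℤ) := by rw [← exp_int_mul]; norm_num
  rw [tripleTerm, h1, h2, h5, ← zpow_mul, zpow_add₀ (exp_ne_zero t), mul_assoc]

theorem tsum_B_exp {t : ℂ} (ht : t.re < 0) :
    ∑' n : ℤ, (-1 : ℂ) ^ n * exp t ^ ((5 * n ^ 2 - n) / 2) = -exp t * thetaB 0 t := by
  have h := tsum_tripleTerm_exp (2 * t) (five_mul_re_neg ht)
  rw [show 2 * t / 2 = t by ring] at h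
  rw [thetaB, ← h]
  refine tsum_congr fun n => ?_
  obtain ⟨m, hm⟩ : Even (n * (n - 1)) := Int.even_mul_pred_self n
  have h1 : n * (n - 1) / 2 = m := by omega
  have h2 : (5 * n ^ 2 - n) / 2 = 5 * m + 2 * n := by
    rw [show 5 * n ^ 2 - n = 5 * (n * (n - 1)) + 4 * n by ring]
    omega
  have h5 : exp (5 * t) = exp t ^ (5 : ℤ) := by rw [← exp_int_mul]; norm_num
  have h6 : exp (2 * t) = exp t ^ (2 : ℤ) := by rw [← exp_int_mul]; norm_num
  rw [tripleTerm, h1, h2, h5, h6, ← zpow_mul, ← zpow_mul, zpow_add₀ (exp_ne_zero t), mul_assoc]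

/-- The function `A` without its factor `q^{1/5}`. -/
noncomputable def cofactorA (q : ℂ) : ℂ :=
  eulerPow q (-3 / 5) * ∑' n : ℤ, (-1) ^ n * q ^ ((5 * n ^ 2 - 3 * n) / 2)

theorem A_eq_mul_cofactorA (r : ℂ → ℂ) (q : ℂ) : A r q = r q * cofactorA q := by
  rw [A, cofactorA, mul_assoc]

theorem cofactorA_exp {t : ℂ} (ht : t.re < 0) :
    cofactorA (exp t) = eulerPow (exp t) (-3 / 5) * (-exp (t / 2) * thetaA 0 t) := by
  rw [cofactorA, tsum_A_exp ht]

theorem B_exp {t : ℂ} (ht : t.re < 0) :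
    B (exp t) = eulerPow (exp t) (-3 / 5) * (-exp t * thetaB 0 t) := by
  rw [B, tsum_B_exp ht]

theorem theta_one_zero_eq {t : ℂ} (ht : t.re < 0) :
    theta 1 0 (5 * t) = euler (exp t ^ 5) ^ 3 := by
  rw [theta_one_zero (five_mul_re_neg ht), ← exp_nat_mul]
  norm_num

/-- The fifth power produces (q;q)_∞^(-3), which the cube of `theta_mul_theta` rewrites in theta
values. -/
theorem cofactorA_pow_five {t : ℂ} (ht : t.re < 0) :
    exp t * cofactorA (exp t) ^ 5 = -alpha t := by
  have h := theta_mul_theta ht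
  change exp (t / 2) * exp t * thetaA 0 t * thetaB 0 t = _ at h
  have hA := thetaA_ne_zero ht
  have hB := thetaB_ne_zero ht
  have hs := exp_ne_zero (t / 2)
  have he := euler_ne_zero (norm_exp_lt_one ht)
  rw [cofactorA_exp ht, mul_pow, eulerPow_pow_five (norm_exp_lt_one ht), alpha,
    theta_one_zero_eq ht]
  have hsq := exp_half_sq t
  generalize euler (exp t ^ 5) = e₅ at *
  generalize euler (exp t) = e₁ at *
  rw [← hsq] at h ⊢
  have h3 := congrArg (· ^ 3) h
  simp only [mul_pow] at h3
  field_simp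
  linear_combination -h3

theorem B_pow_five {t : ℂ} (ht : t.re < 0) : B (exp t) ^ 5 = -beta t := by
  have h := theta_mul_theta ht
  change exp (t / 2) * exp t * thetaA 0 t * thetaB 0 t = _ at h
  have hA := thetaA_ne_zero ht
  have hB := thetaB_ne_zero ht
  have hs := exp_ne_zero (t / 2)
  have he := euler_ne_zero (norm_exp_lt_one ht)
  rw [B_exp ht, mul_pow, eulerPow_pow_five (norm_exp_lt_one ht), beta, theta_one_zero_eq ht]
  have hsq := exp_half_sq t
  generalize euler (exp t ^ 5) = e₅ at *
  generalize euler (exp t) = e₁ at *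
  rw [← hsq] at h ⊢
  have h3 := congrArg (· ^ 3) h
  simp only [mul_pow] at h3
  field_simp
  linear_combination -h3

theorem hasDerivAt_eulerPow_exp {t : ℂ} (s : ℂ) (ht : t.re < 0) :
    HasDerivAt (fun t => eulerPow (exp t) s)
      (eulerPow (exp t) s * (s * ((E₂ (exp t) - 1) / 24))) t := by
  have h := ((hasDerivAt_logEuler_exp 1 (by simpa using ht)).const_mul s).cexp
  simp only [one_mul] at h
  exact h

/-- The term -1/5 compensates the logarithmic derivative of the missing factor q^(1/5). -/
theorem hasDerivAt_cofactorA {t : ℂ} (ht : t.re < 0) :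
    HasDerivAt cofactorA (cofactorA (exp t) * (-1 / 5 + 1 / 60 *
      (-5 * alpha t ^ 2 - 66 * alpha t * beta t + 7 * beta t ^ 2 + 5 * P (exp t))) / exp t)
      (exp t) := by
  have hs : HasDerivAt (fun t : ℂ => exp (t / 2)) (exp (t / 2) * (1 / 2)) t := by
    simpa using ((hasDerivAt_id t).div_const 2).cexp
  have h := (hasDerivAt_eulerPow_exp (-3 / 5) ht).fun_mul
    (hs.fun_neg.fun_mul (hasDerivAt_thetaA_zero ht))
  refine hasDerivAt_of_comp_exp ((h.congr_of_eventuallyEq ?_).congr_deriv ?_)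
  · filter_upwards [(isOpen_lt continuous_re continuous_const).mem_nhds ht] with w hw
    exact cofactorA_exp hw
  · have hc : curvB t = curvA t + alpha t * beta t := by
      linear_combination curvB_sub_curvA ht
    rw [logEuler_deriv_eq ht, hc, zetaA_eq ht, zetaB_eq ht, curvA_eq ht, cofactorA_exp ht]
    ring

theorem hasDerivAt_B {t : ℂ} (ht : t.re < 0) :
    HasDerivAt B (B (exp t) * (1 / 60 *
      (7 * alpha t ^ 2 + 66 * alpha t * beta t - 5 * beta t ^ 2 + 5 * P (exp t))) / exp t)
      (exp t) := by
  have h := (hasDerivAt_eulerPow_exp (-3 / 5) ht).fun_mul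
    ((hasDerivAt_exp t).fun_neg.fun_mul (hasDerivAt_thetaB_zero ht))
  refine hasDerivAt_of_comp_exp ((h.congr_of_eventuallyEq ?_).congr_deriv ?_)
  · filter_upwards [(isOpen_lt continuous_re continuous_const).mem_nhds ht] with w hw
    exact B_exp hw
  · have hc : curvB t = curvA t + alpha t * beta t := by
      linear_combination curvB_sub_curvA ht
    rw [logEuler_deriv_eq ht, hc, zetaA_eq ht, zetaB_eq ht, curvA_eq ht, B_exp ht]
    ring

/-- A continuous branch of the fifth root is differentiable. -/
theorem hasDerivAt_fifth_root {U : Set ℂ} (hU : IsOpen U) {r : ℂ → ℂ} (hr : ContinuousOn r U)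
    (hr5 : ∀ q ∈ U, r q ^ 5 = q) {q : ℂ} (hq : q ∈ U) (hq0 : q ≠ 0) :
    HasDerivAt r (r q / (5 * q)) q := by
  have hrq : r q ≠ 0 := fun h => hq0 (by rw [← hr5 q hq, h]; norm_num)
  have hp : HasDerivAt (fun w : ℂ => w ^ 5) (5 * r q ^ 4) (r q) := by
    simpa using hasDerivAt_pow 5 (r q)
  have h := HasDerivAt.of_local_left_inverse (hr.continuousAt (hU.mem_nhds hq)) hp
    (mul_ne_zero (by norm_num) (pow_ne_zero 4 hrq)) (by
      filter_upwards [hU.mem_nhds hq] with w hw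
      exact hr5 w hw)
  refine h.congr_deriv ?_
  have h5 := hr5 q hq
  field_simp
  linear_combination -h5

end Quintic

theorem theorem1p6 (U : Set ℂ) (hU : IsOpen U) (hU1 : ∀ q ∈ U, 0 < ‖q‖ ∧ ‖q‖ < 1)
    (r : ℂ → ℂ) (hr : ContinuousOn r U) (hr5 : ∀ q ∈ U, r q ^ 5 = q) (q : ℂ) (hq : q ∈ U) :
    (DifferentiableAt ℂ (Quintic.A r) q ∧ DifferentiableAt ℂ Quintic.B q ∧
      DifferentiableAt ℂ Quintic.P q) ∧
    q * deriv (Quintic.A r) q =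
      1 / 60 * Quintic.A r q * (-5 * Quintic.A r q ^ 10 - 66 * Quintic.A r q ^ 5 * Quintic.B q ^ 5
        + 7 * Quintic.B q ^ 10 + 5 * Quintic.P q) ∧
    q * deriv Quintic.B q =
      1 / 60 * Quintic.B q * (7 * Quintic.A r q ^ 10 + 66 * Quintic.A r q ^ 5 * Quintic.B q ^ 5
        - 5 * Quintic.B q ^ 10 + 5 * Quintic.P q) ∧
    q * deriv Quintic.P q =
      5 / 12 * (Quintic.P q ^ 2 - Quintic.B q ^ 20 + 12 * Quintic.B q ^ 15 * Quintic.A r q ^ 5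
        - 14 * Quintic.B q ^ 10 * Quintic.A r q ^ 10 - 12 * Quintic.B q ^ 5 * Quintic.A r q ^ 15
        - Quintic.A r q ^ 20) := by
  open Quintic in
  obtain ⟨hq0, hq1⟩ := hU1 q hq
  have hne : q ≠ 0 := norm_pos_iff.mp hq0
  have hroot := hasDerivAt_fifth_root hU hr hr5 hq hne
  have h5 := hr5 q hq
  -- Any logarithm serves: the branch `r` is never compared with exp(t/5), only its fifth power and
  -- logarithmic derivative enter.
  obtain ⟨t, rfl⟩ : ∃ t, Complex.exp t = q := ⟨Complex.log q, Complex.exp_log hne⟩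
  have ht : t.re < 0 := by rwa [Complex.norm_exp, Real.exp_lt_one_iff] at hq1
  have hA5 : A r (Complex.exp t) ^ 5 = -alpha t := by
    rw [A_eq_mul_cofactorA, mul_pow, h5, cofactorA_pow_five ht]
  have hB5 := B_pow_five ht
  have hA : HasDerivAt (A r) _ (Complex.exp t) :=
    (hroot.fun_mul (hasDerivAt_cofactorA ht)).congr_of_eventuallyEq
      (Filter.Eventually.of_forall fun w => A_eq_mul_cofactorA r w)
  have hB := hasDerivAt_B ht
  have hP := hasDerivAt_of_comp_exp (hasDerivAt_P_exp ht)
  have a10 : A r (Complex.exp t) ^ 10 = alpha t ^ 2 := by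
    rw [show 10 = 5 * 2 by norm_num, pow_mul, hA5]; ring
  have a15 : A r (Complex.exp t) ^ 15 = -alpha t ^ 3 := by
    rw [show 15 = 5 * 3 by norm_num, pow_mul, hA5]; ring
  have a20 : A r (Complex.exp t) ^ 20 = alpha t ^ 4 := by
    rw [show 20 = 5 * 4 by norm_num, pow_mul, hA5]; ring
  have b10 : B (Complex.exp t) ^ 10 = beta t ^ 2 := by
    rw [show 10 = 5 * 2 by norm_num, pow_mul, hB5]; ring
  have b15 : B (Complex.exp t) ^ 15 = -beta t ^ 3 := by
    rw [show 15 = 5 * 3 by norm_num, pow_mul, hB5]; ring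
  have b20 : B (Complex.exp t) ^ 20 = beta t ^ 4 := by
    rw [show 20 = 5 * 4 by norm_num, pow_mul, hB5]; ring
  refine ⟨⟨hA.differentiableAt, hB.differentiableAt, hP.differentiableAt⟩, ?_, ?_, ?_⟩
  · rw [hA.deriv, a10, hA5, hB5, b10, A_eq_mul_cofactorA]
    field_simp
    ring
  · rw [hB.deriv, a10, hA5, hB5, b10]
    field_simp
  · rw [hP.deriv, a10, a15, a20, hA5, hB5, b10, b15, b20]
    field_simp
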